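/- Let $k$ be a field, let $n\ge 1$ and $d\ge 2$, let $R=k[x_1,\ldots,x_n]$ with its standard grading, and let $\mathfrak m=(x_1,\ldots,x_n)$. Let $J$ be a strongly stable monomial ideal of $R$, i.e. $J$ is generated by monomials and, for every monomial $m\in J$, every variable $x_i$ dividing $m$ and every $j<i$, the monomial $(x_j/x_i)m$ also belongs to $J$. Suppose that $J$ is generated in degrees $\ge d$, that $J$ contains every monomial of degree $d$ not divisible by $x_n$, and that $R/J$ is Artinian. For a finitely generated graded $R$-module $M$ let $\beta_p(M)=\dim_k \operatorname{Tor}_p^R(k,M)$, where $k=R/\mathfrak m$, denote its $p$-th total Betti number, that is, the rank of the $p$-th module in its minimal graded free resolution. Then $$\beta_p(R/J)=\beta_p(R/\mathfrak m^{d})=\sum_{i=1}^{n}\binom{d+i-2}{d-1}\binom{i-1}{p-1}\qquad\text{for all } p\ge 1.$$ In particular, $J$ is minimally generated by $\dim_k R_d$ monomials: $J$ has a minimal set of monomial generators (a set of monomials generating $J$ no proper subset of which generates $J$), and every such set has exactly $\dim_k R_d$ elements, where $R_d$ is the space of homogeneous polynomials of degree $d$. -/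

import Mathlib

noncomputable section

namespace StronglyStableBetti

open CategoryTheory

universe u

/-- The maximal homogeneous ideal `(x_1, ..., x_n)` of `k[x_1, ..., x_n]`. -/
def maxIdeal (n : ℕ) (k : Type u) [Field k] : Ideal (MvPolynomial (Fin n) k) :=
  Ideal.span (Set.range MvPolynomial.X)

/-- The `p`-th total Betti number of a module `M` over `R = k[x_1, ..., x_n]`: the dimension over
`k` of `Tor_p^R(k, M)`, where `k = R / (x_1, ..., x_n)`. For a finitely generated graded module
this is the rank of the `p`-th free module in the minimal graded free resolution of `M`.
The dimension is a cardinal, so that an equation with a natural number includes finiteness. -/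
def totalBetti {n : ℕ} {k : Type u} [Field k] (p : ℕ)
    (M : Type u) [AddCommGroup M] [Module (MvPolynomial (Fin n) k) M] : Cardinal.{u} :=
  Module.rank k
    ((ModuleCat.restrictScalars (MvPolynomial.C : k →+* MvPolynomial (Fin n) k)).obj
      (((Tor (ModuleCat.{u} (MvPolynomial (Fin n) k)) p).obj
        (ModuleCat.of _ (MvPolynomial (Fin n) k ⧸ maxIdeal n k))).obj (ModuleCat.of _ M)))

/-- The ideal generated by the monomials whose exponent vectors lie in `S`. -/
def monomialSpan {n : ℕ} (k : Type u) [Field k] (S : Set (Fin n →₀ ℕ)) :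
    Ideal (MvPolynomial (Fin n) k) :=
  Ideal.span ((fun a => MvPolynomial.monomial a (1 : k)) '' S)

/-- A monomial ideal: an ideal generated by monomials. -/
def IsMonomialIdeal {n : ℕ} {k : Type u} [Field k] (J : Ideal (MvPolynomial (Fin n) k)) : Prop :=
  ∃ S : Set (Fin n →₀ ℕ), J = monomialSpan k S

/-- A strongly stable monomial ideal: whenever a monomial `m` lies in `J`, the variable `x_i`
divides `m` and `j < i`, the monomial `(x_j / x_i) m` lies in `J`. -/
def IsStronglyStable {n : ℕ} {k : Type u} [Field k] (J : Ideal (MvPolynomial (Fin n) k)) : Prop :=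
  IsMonomialIdeal J ∧
    ∀ a : Fin n →₀ ℕ, MvPolynomial.monomial a (1 : k) ∈ J →
      ∀ i : Fin n, 1 ≤ a i → ∀ j : Fin n, j < i →
        MvPolynomial.monomial (a - Finsupp.single i 1 + Finsupp.single j 1) (1 : k) ∈ J

/-- `J` is generated by homogeneous polynomials of degrees at least `d`. -/
def GeneratedInDegreesGE {n : ℕ} {k : Type u} [Field k]
    (J : Ideal (MvPolynomial (Fin n) k)) (d : ℕ) : Prop :=
  ∃ G : Set (MvPolynomial (Fin n) k),
    (∀ g ∈ G, ∃ e : ℕ, d ≤ e ∧ g.IsHomogeneous e) ∧ J = Ideal.span G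

/-- The monomials with exponent vectors in `S` generate `J`, and no proper subset of them does. -/
def MinimallyGenerates {n : ℕ} {k : Type u} [Field k]
    (S : Set (Fin n →₀ ℕ)) (J : Ideal (MvPolynomial (Fin n) k)) : Prop :=
  monomialSpan k S = J ∧ ∀ T : Set (Fin n →₀ ℕ), T ⊂ S → monomialSpan k T ≠ J

end StronglyStableBetti

end

noncomputable section

namespace StronglyStableBetti

open CategoryTheory MvPolynomial

universe u

/-! Order the minimal monomial generators of a strongly stable ideal by degree, then reverse
lexicographically. For each generator `u` with largest variable `x_m`, the colon ideal of the
earlier generators by `u` is `(x_j : j < m)`: the ideal has linear quotients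
(`IsStableSet.linearPresentation`).

Linear quotients pass to syzygies. The relations `x_j u = ...` generate the first syzygy module, and
in lexicographic order the colon ideal at `(u, j)` is `(x_i : i < j)` (`LinearPresentation.syzygy`).
All entries of these relations lie in `𝔪`, so iteration yields a minimal free resolution, and
counting its generators gives the Eliahou-Kervaire formula `β_{p+1}(R/J) = ∑_u C(m(u) - 1, p)`, with
`m(u)` the index of the largest variable of `u`.

Only the distribution of largest variables then matters. Replacing the exponent of `x_n` by the
least one that puts the monomial in `J` maps the monomials of degree `d` bijectively onto the
minimal generators of `J` (`image_toMinGen`) and preserves the support (`belowMax_toMinGen`). Hence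
every such `J`, and `𝔪^d` among them, has the Betti numbers obtained by counting monomials of degree
`d` by largest variable (`sum_choose_card_belowMax`). -/

/-! ### Total Betti numbers from a minimal free resolution -/

open TensorProduct in
/-- A map of free modules with entries in `I` vanishes modulo `I`. -/
lemma lTensor_quotient_eq_zero {R : Type*} [CommRing R] (I : Ideal R) {α β : Type*} [Fintype β]
    (f : (α → R) →ₗ[R] (β → R)) (hf : ∀ x i, f x i ∈ I) : f.lTensor (R ⧸ I) = 0 := by
  classical
  refine TensorProduct.ext' fun a x => ?_
  apply (TensorProduct.piScalarRight R R (R ⧸ I) β).injective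
  rw [LinearMap.zero_apply, map_zero, LinearMap.lTensor_tmul]
  ext i
  obtain ⟨a, rfl⟩ := Ideal.Quotient.mk_surjective a
  rw [TensorProduct.piScalarRight_apply, TensorProduct.piScalarRightHom_tmul, Pi.zero_apply]
  change Ideal.Quotient.mk I (f x i * a) = 0
  exact Ideal.Quotient.eq_zero_iff_mem.2 (Ideal.mul_mem_right _ _ (hf x i))

variable {n : ℕ} {k : Type u} [Field k]

/-- The iterated syzygy modules of `M`, each with a free cover `(ι p → R) → syz p`, such that
`syz (p + 1)` is the kernel of the cover of `syz p` and is contained in `𝔪 (ι p → R)`. -/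
structure MinimalSyzygies (M : Type u) [AddCommGroup M] [Module (MvPolynomial (Fin n) k) M] where
  syz : ℕ → ModuleCat.{u} (MvPolynomial (Fin n) k)
  ι : ℕ → Type
  fintype : ∀ p, Fintype (ι p)
  cover : ∀ p, (ι p → MvPolynomial (Fin n) k) →ₗ[MvPolynomial (Fin n) k] syz p
  cover_surjective : ∀ p, Function.Surjective (cover p)
  incl : ∀ p, syz (p + 1) →ₗ[MvPolynomial (Fin n) k] (ι p → MvPolynomial (Fin n) k)
  incl_injective : ∀ p, Function.Injective (incl p)
  range_incl : ∀ p, LinearMap.range (incl p) = LinearMap.ker (cover p)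
  incl_mem : ∀ p x i, incl p x i ∈ maxIdeal n k
  base : syz 0 ≃ₗ[MvPolynomial (Fin n) k] M

namespace MinimalSyzygies

variable {M : Type u} [AddCommGroup M] [Module (MvPolynomial (Fin n) k) M]
  (S : MinimalSyzygies (n := n) (k := k) M)

attribute [instance] MinimalSyzygies.fintype

lemma cover_incl (p : ℕ) : S.cover p ∘ₗ S.incl p = 0 := by
  ext x
  have : S.incl p x ∈ LinearMap.ker (S.cover p) := S.range_incl p ▸ LinearMap.mem_range_self _ x
  simpa using this

def d (p : ℕ) : (S.ι (p + 1) → MvPolynomial (Fin n) k) →ₗ[MvPolynomial (Fin n) k]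
    (S.ι p → MvPolynomial (Fin n) k) := S.incl p ∘ₗ S.cover (p + 1)

lemma range_d (p : ℕ) : LinearMap.range (S.d p) = LinearMap.ker (S.cover p) := by
  rw [d, LinearMap.range_comp, LinearMap.range_eq_top.2 (S.cover_surjective _),
    Submodule.map_top, S.range_incl]

lemma ker_d (p : ℕ) : LinearMap.ker (S.d p) = LinearMap.ker (S.cover (p + 1)) := by
  rw [d, LinearMap.ker_comp_of_ker_eq_bot _ (LinearMap.ker_eq_bot.2 (S.incl_injective p))]

def complex : ChainComplex (ModuleCat.{u} (MvPolynomial (Fin n) k)) ℕ :=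
  ChainComplex.of (fun p => ModuleCat.of _ (S.ι p → MvPolynomial (Fin n) k))
    (fun p => ModuleCat.ofHom (S.d p)) (fun p => by
      rw [← ModuleCat.ofHom_comp, d, d, LinearMap.comp_assoc,
        ← LinearMap.comp_assoc _ (S.incl (p + 1)), cover_incl, LinearMap.zero_comp,
        LinearMap.comp_zero]
      rfl)

lemma complex_d (p : ℕ) : S.complex.d (p + 1) p = ModuleCat.ofHom (S.d p) :=
  ChainComplex.of_d (fun p => ModuleCat.of _ (S.ι p → MvPolynomial (Fin n) k))
    (fun p => ModuleCat.ofHom (S.d p)) p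

def augmentation : S.complex.X 0 ⟶ ModuleCat.of _ M :=
  ModuleCat.ofHom (S.base.toLinearMap ∘ₗ S.cover 0)

lemma exact_augmentation (w : S.complex.d 1 0 ≫ S.augmentation = 0) :
    (ShortComplex.mk _ _ w).Exact := by
  rw [ShortComplex.moduleCat_exact_iff_range_eq_ker]
  change LinearMap.range (S.complex.d 1 0).hom = LinearMap.ker (S.base.toLinearMap ∘ₗ S.cover 0)
  rw [complex_d, LinearMap.ker_comp_of_ker_eq_bot _ S.base.ker]
  exact S.range_d 0

lemma complex_d_augmentation : S.complex.d 1 0 ≫ S.augmentation = 0 := by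
  rw [complex_d]
  ext1
  have h := S.range_d 0
  change (S.base.toLinearMap ∘ₗ S.cover 0) ∘ₗ S.d 0 = 0
  rw [LinearMap.comp_assoc, LinearMap.range_le_ker_iff.1 h.le, LinearMap.comp_zero]

lemma complex_exactAt_succ (p : ℕ) : S.complex.ExactAt (p + 1) := by
  rw [HomologicalComplex.exactAt_iff' _ (p + 1 + 1) (p + 1) p (by simp) (by simp)]
  rw [ShortComplex.moduleCat_exact_iff_range_eq_ker]
  change LinearMap.range (S.complex.d _ _).hom = LinearMap.ker (S.complex.d _ _).hom
  rw [complex_d, complex_d]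
  exact (S.range_d _).trans (S.ker_d _).symm

instance (p : ℕ) : Projective (S.complex.X p) :=
  ModuleCat.projective_of_free (Pi.basisFun (MvPolynomial (Fin n) k) (S.ι p))

instance : Epi S.augmentation :=
  (ModuleCat.epi_iff_surjective _).2 (S.base.surjective.comp (S.cover_surjective 0))

def resolution : ProjectiveResolution (ModuleCat.of (MvPolynomial (Fin n) k) M) where
  complex := S.complex
  π := (ChainComplex.toSingle₀Equiv _ _).symm ⟨S.augmentation, S.complex_d_augmentation⟩
  quasiIso := ⟨fun p => by
    cases p
    · rw [ChainComplex.quasiIsoAt₀_iff, ShortComplex.quasiIso_iff_of_zeros']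
      · refine (ShortComplex.exact_and_epi_g_iff_of_iso ?_).2
          ⟨S.exact_augmentation S.complex_d_augmentation, inferInstanceAs (Epi S.augmentation)⟩
        exact ShortComplex.isoMk (Iso.refl _) (Iso.refl _) (Iso.refl _)
          ((Category.id_comp (S.complex.d 1 0)).trans (Category.comp_id _).symm)
          ((Category.id_comp S.augmentation).trans (Category.comp_id _).symm)
      all_goals rfl
    · rw [quasiIsoAt_iff_exactAt']
      · apply S.complex_exactAt_succ
      · apply ChainComplex.exactAt_succ_single_obj⟩

lemma d_mem (p : ℕ) (x : S.ι (p + 1) → MvPolynomial (Fin n) k) (i : S.ι p) :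
    S.d p x i ∈ maxIdeal n k := S.incl_mem _ _ _

lemma lTensor_d_eq_zero (p : ℕ) :
    (S.d p).lTensor (MvPolynomial (Fin n) k ⧸ maxIdeal n k) = 0 :=
  lTensor_quotient_eq_zero _ _ (S.d_mem p)

open MonoidalCategory in
def tensorComplex : ChainComplex (ModuleCat.{u} (MvPolynomial (Fin n) k)) ℕ :=
  (((tensoringLeft (ModuleCat.{u} (MvPolynomial (Fin n) k))).obj
    (ModuleCat.of _ (MvPolynomial (Fin n) k ⧸ maxIdeal n k))).mapHomologicalComplex _).obj S.complex

/-- Minimality is used here: with zero differentials, `Tor_p` is the whole `p`-th term of the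
tensored complex. -/
lemma tensorComplex_d (p q : ℕ) : S.tensorComplex.d p q = 0 := by
  by_cases h : q + 1 = p
  · subst h
    change (MonoidalCategory.whiskerLeft (ModuleCat.of (MvPolynomial (Fin n) k)
      (MvPolynomial (Fin n) k ⧸ maxIdeal n k)) (S.complex.d (q + 1) q)) = 0
    rw [complex_d]
    ext1
    exact S.lTensor_d_eq_zero q
  · exact S.tensorComplex.shape _ _ h

def tensorComplexHomologyIso (p : ℕ) : S.tensorComplex.homology p ≅ S.tensorComplex.X p :=
  (ShortComplex.HomologyData.ofZeros (S.tensorComplex.sc p)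
    (S.tensorComplex_d _ _) (S.tensorComplex_d _ _)).left.homologyIso

open MonoidalCategory in
def torIso (p : ℕ) :
    (((Tor (ModuleCat.{u} (MvPolynomial (Fin n) k)) p).obj
        (ModuleCat.of _ (MvPolynomial (Fin n) k ⧸ maxIdeal n k))).obj (ModuleCat.of _ M)) ≅
      S.tensorComplex.X p :=
  S.resolution.isoLeftDerivedObj ((tensoringLeft (ModuleCat.{u} (MvPolynomial (Fin n) k))).obj
    (ModuleCat.of _ (MvPolynomial (Fin n) k ⧸ maxIdeal n k))) p ≪≫ S.tensorComplexHomologyIso p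

open TensorProduct in
def tensorComplexXIso (p : ℕ) : S.tensorComplex.X p ≅
    ModuleCat.of (MvPolynomial (Fin n) k)
      (S.ι p → MvPolynomial (Fin n) k ⧸ maxIdeal n k) :=
  letI := Classical.decEq (S.ι p)
  (TensorProduct.piScalarRight (MvPolynomial (Fin n) k) (MvPolynomial (Fin n) k)
    (MvPolynomial (Fin n) k ⧸ maxIdeal n k) (S.ι p)).toModuleIso

end MinimalSyzygies

variable (n k) in
lemma rank_quotient_maxIdeal :
    Module.rank k (MvPolynomial (Fin n) k ⧸ maxIdeal n k) = 1 := by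
  let f : (MvPolynomial (Fin n) k ⧸ maxIdeal n k) →ₐ[k] k :=
    Ideal.Quotient.liftₐ _ (aeval (fun _ => (0 : k))) (fun a ha => by
      have : maxIdeal n k ≤ RingHom.ker (aeval (fun _ => (0 : k)) : MvPolynomial (Fin n) k →ₐ[k] k) := by
        rw [maxIdeal, Ideal.span_le]
        rintro _ ⟨i, rfl⟩
        simp
      exact this ha)
  have hf : Function.Bijective f := by
    refine ⟨?_, fun c => ⟨algebraMap _ _ c, by simp⟩⟩
    rw [injective_iff_map_eq_zero]
    intro a ha
    obtain ⟨a, rfl⟩ := Ideal.Quotient.mk_surjective a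
    rw [Ideal.Quotient.eq_zero_iff_mem]
    replace ha : aeval (fun _ => (0 : k)) a = 0 := ha
    -- For the first power of the ideal the criterion concerns only the constant coefficient, which
    -- is the value at the origin.
    have h1 := (mem_pow_idealOfVars_iff' (σ := Fin n) (R := k) 1 a).2 fun x hx => by
      obtain rfl : x = 0 := by
        rw [← Finsupp.degree_eq_zero_iff]; omega
      rw [← constantCoeff_eq]
      rw [← ha]
      simp [aeval_zero']
    rwa [pow_one] at h1
  rw [(LinearEquiv.ofBijective f.toLinearMap hf).rank_eq, Module.rank_self]

lemma totalBetti_congr_iso {p : ℕ} {M : Type u} [AddCommGroup M]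
    [Module (MvPolynomial (Fin n) k) M] {ι : Type} [Fintype ι]
    (e : (((Tor (ModuleCat.{u} (MvPolynomial (Fin n) k)) p).obj
        (ModuleCat.of _ (MvPolynomial (Fin n) k ⧸ maxIdeal n k))).obj (ModuleCat.of _ M)) ≅
      ModuleCat.of (MvPolynomial (Fin n) k)
        (ι → MvPolynomial (Fin n) k ⧸ maxIdeal n k)) :
    totalBetti (n := n) (k := k) p M = Fintype.card ι := by
  have := (((ModuleCat.restrictScalars
    (MvPolynomial.C : k →+* MvPolynomial (Fin n) k)).mapIso e).toLinearEquiv).rank_eq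
  rw [totalBetti, this]
  have h2 : Module.rank k (ι → MvPolynomial (Fin n) k ⧸ maxIdeal n k) = Fintype.card ι := by
    simp [rank_pi, rank_quotient_maxIdeal]
  rw [← h2]
  -- The identity map, comparing scalars restricted along `C` with the `k`-algebra structure of the
  -- quotient.
  refine LinearEquiv.rank_eq (R := k) (LinearEquiv.mk ⟨⟨fun x => x, fun _ _ => rfl⟩, ?_⟩ (fun x => x)
    (fun _ => rfl) (fun _ => rfl))
  intro c x
  exact algebraMap_smul (MvPolynomial (Fin n) k) c
    (show ι → MvPolynomial (Fin n) k ⧸ maxIdeal n k from x)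

theorem MinimalSyzygies.totalBetti_eq {M : Type u} [AddCommGroup M]
    [Module (MvPolynomial (Fin n) k) M] (S : MinimalSyzygies (n := n) (k := k) M) (p : ℕ) :
    totalBetti (n := n) (k := k) p M = Fintype.card (S.ι p) :=
  totalBetti_congr_iso (S.torIso p ≪≫ S.tensorComplexXIso p)

/-! ### Modules with linear quotients and their syzygies -/

lemma mem_maxIdeal_pow_iff {D : ℕ} {c : MvPolynomial (Fin n) k} :
    c ∈ maxIdeal n k ^ D ↔ ∀ x ∈ c.support, D ≤ x.degree :=
  mem_pow_idealOfVars_iff D c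

lemma X_mem_maxIdeal (i : Fin n) : (X i : MvPolynomial (Fin n) k) ∈ maxIdeal n k :=
  Ideal.subset_span ⟨i, rfl⟩

/-- An element of `(x_j : j ∈ A) ∩ 𝔪 ^ D` is a combination of the `x_j`, `j ∈ A`, with
coefficients in `𝔪 ^ (D - 1)`. -/
lemma exists_sum_X_mul_of_mem_span {A : Finset (Fin n)} {D : ℕ} {c : MvPolynomial (Fin n) k}
    (hc : c ∈ Ideal.span (X '' (A : Set (Fin n)))) (hD : c ∈ maxIdeal n k ^ D) :
    ∃ b : Fin n → MvPolynomial (Fin n) k, (∀ j, b j ∈ maxIdeal n k ^ (D - 1)) ∧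
      c = ∑ j ∈ A, b j * X j := by
  classical
  rw [mem_ideal_span_X_image] at hc
  rw [mem_maxIdeal_pow_iff] at hD
  -- Both hypotheses are conditions on single terms, so each term can be divided by one variable.
  have key : ∀ m ∈ c.support, ∃ b : Fin n → MvPolynomial (Fin n) k,
      (∀ j, b j ∈ maxIdeal n k ^ (D - 1)) ∧ monomial m (coeff m c) = ∑ j ∈ A, b j * X j := by
    intro m hm
    obtain ⟨i, hi, hmi⟩ := hc m hm
    have hle : Finsupp.single i 1 ≤ m := by
      rw [Finsupp.single_le_iff]; omega
    refine ⟨Pi.single i (monomial (m - Finsupp.single i 1) (coeff m c)), ?_, ?_⟩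
    · intro j
      by_cases hj : j = i
      · subst hj
        rw [Pi.single_eq_same, mem_maxIdeal_pow_iff]
        intro x hx
        have := support_monomial_subset hx
        rw [Finset.mem_singleton] at this
        subst this
        have h2 := congrArg Finsupp.degree (tsub_add_cancel_of_le hle)
        rw [map_add, Finsupp.degree_single] at h2
        have := hD m hm
        omega
      · simp [Pi.single_eq_of_ne hj]
    · rw [Finset.sum_eq_single i]
      · rw [Pi.single_eq_same, X, monomial_mul, tsub_add_cancel_of_le hle, mul_one]
      · intro j _ hj
        simp [Pi.single_eq_of_ne hj]
      · exact fun h => absurd hi h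
  choose! b hb hb' using key
  refine ⟨fun j => ∑ m ∈ c.support, b m j, fun j => Ideal.sum_mem _ fun m hm => hb m hm j, ?_⟩
  conv_lhs => rw [c.as_sum]
  rw [Finset.sum_congr rfl hb', Finset.sum_comm]
  simp [Finset.sum_mul]

/-- The linear syzygies of the variables: `x_i, i < j` generate `(x_i : i < j) : x_j`. -/
lemma mem_span_X_of_sum_eq_zero {A : Finset (Fin n)} {j : Fin n} (hj : j ∈ A)
    {c : Fin n → MvPolynomial (Fin n) k} (hc : ∀ i, j < i → c i = 0)
    (h : ∑ i ∈ A, c i * X i = 0) :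
    c j ∈ Ideal.span (X '' ((A.filter (· < j) : Finset (Fin n)) : Set (Fin n))) := by
  classical
  rw [mem_ideal_span_X_image]
  intro m hm
  by_contra! hcon
  -- If no `x_i` with `i < j` divides `x^m`, only the summand `c_j x_j` can contribute to this
  -- coefficient.
  have h0 := congrArg (coeff (m + Finsupp.single j 1)) h
  rw [coeff_sum, Finset.sum_eq_single j, coeff_mul_X, coeff_zero] at h0
  · exact mem_support_iff.1 hm h0
  · intro i hi hij
    rcases lt_or_gt_of_ne hij with hlt | hgt
    · rw [coeff_mul_X', if_neg]
      rw [Finsupp.mem_support_iff, not_not]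
      simp [hcon i (by simp [hi, hlt]), hij.symm]
    · simp [hc i hgt]
  · exact fun h => absurd hj h

/-- The combinatorial data of a module with linear quotients: generators `e s` of degree `deg s`
such that the annihilator of `e s` modulo the previous generators is `(x_j : j ∈ A s)`. -/
structure LinearData (n : ℕ) where
  ι : Type
  fintype : Fintype ι
  linearOrder : LinearOrder ι
  deg : ι → ℕ
  A : ι → Finset (Fin n)

attribute [instance] LinearData.fintype LinearData.linearOrder

/-- Generators `e` of `M` realizing the linear data `D`. -/
structure LinearPresentation (D : LinearData n) (M : Type u) [AddCommGroup M]
    [Module (MvPolynomial (Fin n) k) M] (e : D.ι → M) : Prop where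
  monotone_deg : Monotone D.deg
  span_eq_top : Submodule.span (MvPolynomial (Fin n) k) (Set.range e) = ⊤
  -- `rel` and `ann` are the two inclusions of the colon ideal. Powers of `𝔪` replace a grading on
  -- `M`: a coefficient of `e t` with `t < s` has a positive exponent because `deg` is monotone, and
  -- this makes the resolution minimal.
  rel : ∀ s, ∀ j ∈ D.A s, ∃ c : D.ι → MvPolynomial (Fin n) k,
    (∀ t, c t ∈ maxIdeal n k ^ (D.deg s + 1 - D.deg t)) ∧ (∀ t, s ≤ t → c t = 0) ∧
      (X j : MvPolynomial (Fin n) k) • e s = ∑ t, c t • e t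
  ann : ∀ (c : D.ι → MvPolynomial (Fin n) k) (s), (∀ t, s < t → c t = 0) →
    ∑ t, c t • e t = 0 → c s ∈ Ideal.span (X '' (D.A s : Set (Fin n)))

namespace LinearData

/-- The data of the first syzygy module. -/
def syzygy (D : LinearData n) : LinearData n where
  ι := Σ s : D.ι, D.A s
  fintype := inferInstance
  linearOrder := LinearOrder.lift' (fun s => toLex (s.1, s.2.1)) fun s t h => by
    obtain ⟨s, j⟩ := s
    obtain ⟨t, l⟩ := t
    simp only [EmbeddingLike.apply_eq_iff_eq, Prod.mk.injEq] at h
    obtain ⟨rfl, h⟩ := h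
    rw [Subtype.ext h]
  deg s := D.deg s.1 + 1
  A s := (D.A s.1).filter (· < s.2.1)

lemma syzygy_lt_iff {D : LinearData n} {s t : D.syzygy.ι} :
    s < t ↔ s.1 < t.1 ∨ s.1 = t.1 ∧ s.2.1 < t.2.1 :=
  Prod.Lex.toLex_lt_toLex (x := (s.1, s.2.1)) (y := (t.1, t.2.1))

lemma syzygy_le_iff {D : LinearData n} {s t : D.syzygy.ι} :
    s ≤ t ↔ s.1 < t.1 ∨ s.1 = t.1 ∧ s.2.1 ≤ t.2.1 :=
  Prod.Lex.toLex_le_toLex (x := (s.1, s.2.1)) (y := (t.1, t.2.1))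

/-- Counts the `(p + 1)`-subsets of `A` by their largest element. -/
lemma sum_choose_card_filter_lt {α : Type*} [LinearOrder α] (A : Finset α) (p : ℕ) :
    ∑ j ∈ A, (A.filter (· < j)).card.choose p = A.card.choose (p + 1) := by
  classical
  induction A using Finset.induction_on_max with
  | empty => simp
  | insert a A hA ih =>
    have ha : a ∉ A := fun h => lt_irrefl _ (hA a h)
    rw [Finset.sum_insert ha, Finset.card_insert_of_notMem ha, Nat.choose_succ_succ, ← ih]
    congr 1
    · congr 2
      ext x
      simp only [Finset.mem_filter, Finset.mem_insert]
      constructor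
      · rintro ⟨rfl | h, h'⟩
        · exact absurd h' (lt_irrefl _)
        · exact h
      · exact fun h => ⟨Or.inr h, hA x h⟩
    · refine Finset.sum_congr rfl fun j hj => ?_
      rw [Finset.filter_insert, if_neg (hA j hj).not_gt]

/-- The data of the `p`-th syzygy module. -/
def iterSyzygy (D : LinearData n) : ℕ → LinearData n
  | 0 => D
  | p + 1 => (D.iterSyzygy p).syzygy

lemma sum_syzygy_choose (D : LinearData n) (q : ℕ) :
    ∑ s : D.syzygy.ι, (D.syzygy.A s).card.choose q = ∑ s : D.ι, (D.A s).card.choose (q + 1) := by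
  have h1 : ∑ s : D.syzygy.ι, (D.syzygy.A s).card.choose q =
      ∑ s : D.ι, ∑ j : D.A s, ((D.A s).filter (· < j.1)).card.choose q :=
    Fintype.sum_sigma _
  rw [h1]
  refine Finset.sum_congr rfl fun s _ => ?_
  rw [← sum_choose_card_filter_lt, ← Finset.sum_coe_sort (D.A s)]

/-- Each passage to syzygies raises the lower index by one, so `q` stays free in the induction; `q =
0` counts generators. -/
lemma sum_iterSyzygy_choose (D : LinearData n) (p q : ℕ) :
    ∑ s : (D.iterSyzygy p).ι, ((D.iterSyzygy p).A s).card.choose q =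
      ∑ s : D.ι, (D.A s).card.choose (p + q) := by
  induction p generalizing q with
  | zero =>
    rw [zero_add]
    rfl
  | succ p ih =>
    rw [iterSyzygy, sum_syzygy_choose, ih, show p + (q + 1) = p + 1 + q by omega]

lemma card_iterSyzygy (D : LinearData n) (p : ℕ) :
    Fintype.card (D.iterSyzygy p).ι = ∑ s : D.ι, (D.A s).card.choose p := by
  have := D.sum_iterSyzygy_choose p 0
  simpa using this

end LinearData

namespace LinearPresentation

variable {D : LinearData n} {M : Type u} [AddCommGroup M] [Module (MvPolynomial (Fin n) k) M]
  {e : D.ι → M} (h : LinearPresentation (k := k) D M e)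

/-- The coefficients of the linear relation `x_j e_s = ∑ c_t e_t`. -/
def relCoeff (s : D.ι) (j : D.A s) : D.ι → MvPolynomial (Fin n) k := (h.rel s j.1 j.2).choose

lemma relCoeff_mem (s : D.ι) (j : D.A s) (t : D.ι) :
    h.relCoeff s j t ∈ maxIdeal n k ^ (D.deg s + 1 - D.deg t) :=
  (h.rel s j.1 j.2).choose_spec.1 t

lemma relCoeff_eq_zero {s : D.ι} (j : D.A s) {t : D.ι} (hst : s ≤ t) : h.relCoeff s j t = 0 :=
  (h.rel s j.1 j.2).choose_spec.2.1 t hst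

lemma sum_relCoeff (s : D.ι) (j : D.A s) :
    ∑ t, h.relCoeff s j t • e t = (X j.1 : MvPolynomial (Fin n) k) • e s :=
  (h.rel s j.1 j.2).choose_spec.2.2.symm

/-- The linear syzygies. -/
def syzVec (s : D.syzygy.ι) : D.ι → MvPolynomial (Fin n) k :=
  Pi.single s.1 (X s.2.1) - h.relCoeff s.1 s.2

lemma syzVec_self (s : D.syzygy.ι) : h.syzVec s s.1 = X s.2.1 := by
  simp [syzVec, h.relCoeff_eq_zero s.2 le_rfl]

lemma syzVec_of_lt {s : D.syzygy.ι} {t : D.ι} (hst : s.1 < t) : h.syzVec s t = 0 := by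
  simp [syzVec, h.relCoeff_eq_zero s.2 hst.le, hst.ne']

lemma syzVec_mem (s : D.syzygy.ι) (t : D.ι) :
    h.syzVec s t ∈ maxIdeal n k ^ (D.deg s.1 + 1 - D.deg t) := by
  refine Ideal.sub_mem _ ?_ (h.relCoeff_mem _ _ _)
  by_cases hst : t = s.1
  · subst hst
    simpa using X_mem_maxIdeal _
  · simp [Pi.single_eq_of_ne hst]

variable (k e) in
/-- The relations between the generators. -/
abbrev syzygies : Submodule (MvPolynomial (Fin n) k) (D.ι → MvPolynomial (Fin n) k) :=
  LinearMap.ker (Fintype.linearCombination (MvPolynomial (Fin n) k) e)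

omit h in
lemma mem_syzygies {z : D.ι → MvPolynomial (Fin n) k} :
    z ∈ syzygies k e ↔ ∑ t, z t • e t = 0 := by
  rw [LinearMap.mem_ker, Fintype.linearCombination_apply]

lemma syzVec_mem_syzygies (s : D.syzygy.ι) : h.syzVec s ∈ syzygies k e := by
  rw [mem_syzygies]
  simp only [syzVec, Pi.sub_apply, sub_smul, Finset.sum_sub_distrib, sum_relCoeff]
  rw [Finset.sum_eq_single s.1]
  · simp
  · intro t _ ht
    simp [Pi.single_eq_of_ne ht]
  · simp

include h in
/-- Division by the linear syzygies. -/
lemma exists_eq_sum_syzVec (s : WithTop D.ι) (N : ℕ) (z : D.ι → MvPolynomial (Fin n) k)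
    (hz : z ∈ syzygies k e) (hzN : ∀ t, z t ∈ maxIdeal n k ^ (N - D.deg t))
    (hzs : ∀ t : D.ι, s ≤ t → z t = 0) :
    ∃ b : D.syzygy.ι → MvPolynomial (Fin n) k,
      (∀ t, b t ∈ maxIdeal n k ^ (N - D.syzygy.deg t)) ∧ (∀ t, s ≤ (t.1 : D.ι) → b t = 0) ∧
        z = ∑ t, b t • h.syzVec t := by
  classical
  -- The bound `s` limits the support of `z`; the value `⊤` means no restriction.
  induction s using WellFoundedLT.induction generalizing z with
  | ind s ih =>
  by_cases hz0 : z = 0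
  · exact ⟨0, by simp, by simp, by simp [hz0]⟩
  obtain ⟨t₀, ht₀⟩ := Function.ne_iff.1 hz0
  obtain ⟨s', hs', hmax⟩ := Finset.exists_max_image (Finset.univ.filter fun t => z t ≠ 0) id
    ⟨t₀, by simpa using ht₀⟩
  simp only [Finset.mem_filter, Finset.mem_univ, true_and, id] at hs' hmax
  have hs's : (s' : WithTop D.ι) < s := by
    by_contra hcon
    exact hs' (hzs s' (not_lt.1 hcon))
  have hbig : ∀ t, s' < t → z t = 0 := fun t ht => by
    by_contra hcon
    exact absurd (hmax t hcon) (not_le.2 ht)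
  -- By `ann`, the last nonzero entry of `z` is a combination of the `x_j` with `j ∈ A s'`. These
  -- are the last entries of the linear syzygies over `s'`, so subtracting `w` cancels it.
  obtain ⟨b, hb, hbz⟩ := exists_sum_X_mul_of_mem_span
    (h.ann z s' hbig (mem_syzygies.1 hz)) (hzN s')
  set w : D.ι → MvPolynomial (Fin n) k := ∑ j : D.A s', b j.1 • h.syzVec ⟨s', j⟩ with hw
  have hwt : ∀ t, w t = ∑ j : D.A s', b j.1 * h.syzVec ⟨s', j⟩ t := fun t => by
    simp [hw, Finset.sum_apply]
  have hw1 : z - w ∈ syzygies k e := by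
    exact Submodule.sub_mem _ hz
      (Submodule.sum_mem _ fun j _ => Submodule.smul_mem _ _ (h.syzVec_mem_syzygies _))
  have hw2 : ∀ t, (z - w) t ∈ maxIdeal n k ^ (N - D.deg t) := by
    intro t
    refine Ideal.sub_mem _ (hzN t) ?_
    rw [hwt]
    refine Ideal.sum_mem _ fun j _ => ?_
    by_cases hst : s' < t
    · simp [h.syzVec_of_lt (s := (⟨s', j⟩ : D.syzygy.ι)) hst]
    · have := h.monotone_deg (not_lt.1 hst)
      refine Ideal.pow_le_pow_right ?_ (pow_add (maxIdeal n k) _ _ ▸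
        Ideal.mul_mem_mul (hb j.1) (h.syzVec_mem ⟨s', j⟩ t))
      dsimp only
      omega
  have hw3 : ∀ t : D.ι, (s' : WithTop D.ι) ≤ t → (z - w) t = 0 := by
    intro t hst
    rw [WithTop.coe_le_coe] at hst
    rw [Pi.sub_apply, hwt]
    rcases hst.eq_or_lt with rfl | hlt
    · rw [sub_eq_zero, hbz, ← Finset.sum_coe_sort (D.A s')]
      exact Finset.sum_congr rfl fun j _ => by rw [h.syzVec_self ⟨s', j⟩]
    · rw [hbig t hlt, zero_sub, neg_eq_zero]
      refine Finset.sum_eq_zero fun j _ => ?_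
      rw [h.syzVec_of_lt (s := (⟨s', j⟩ : D.syzygy.ι)) hlt, mul_zero]
  obtain ⟨b', hb', hb's, hb'z⟩ := ih s' hs's (z - w) hw1 hw2 hw3
  refine ⟨fun t => b' t + if t.1 = s' then b t.2.1 else 0, ?_, ?_, ?_⟩
  · intro t
    refine Ideal.add_mem _ (hb' t) ?_
    split_ifs with hts
    · have := hb t.2.1
      rwa [Nat.sub_sub, ← hts] at this
    · exact Ideal.zero_mem _
  · intro t hst
    have h1 : (s' : WithTop D.ι) < (t.1 : D.ι) := hs's.trans_le hst
    simp [hb's t h1.le, (WithTop.coe_lt_coe.1 h1).ne']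
  · simp only [add_smul, Finset.sum_add_distrib]
    rw [← hb'z, eq_comm, ← eq_sub_iff_add_eq', sub_sub_cancel]
    refine (Fintype.sum_sigma _).trans ?_
    rw [Finset.sum_eq_single s']
    · simp [hw]
    · intro t _ hts
      simp [hts]
    · simp

/-- The generators of the syzygy module. -/
def syzGen (s : D.syzygy.ι) : syzygies k e := ⟨h.syzVec s, h.syzVec_mem_syzygies s⟩

lemma span_syzGen : Submodule.span (MvPolynomial (Fin n) k) (Set.range h.syzGen) = ⊤ := by
  rw [eq_top_iff]
  rintro ⟨z, hz⟩ -
  -- With `N = 0` and bound `⊤` the degree and support conditions are empty.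
  obtain ⟨b, -, -, hb⟩ := h.exists_eq_sum_syzVec ⊤ 0 z hz (by simp) (by simp)
  have : (⟨z, hz⟩ : syzygies k e) = ∑ t, b t • h.syzGen t := by
    apply Subtype.ext
    simpa [syzGen] using hb
  rw [this]
  exact Submodule.sum_mem _ fun t _ => Submodule.smul_mem _ _ (Submodule.subset_span ⟨t, rfl⟩)

/-- In the S-pair `x_i (s, j) - x_j (s, i)` the entries `x_i x_j` at `s` cancel. The rest is
supported before `s`, so division expresses it by linear syzygies over earlier generators. -/
lemma syzGen_rel (s : D.syzygy.ι) (i : Fin n) (hi : i ∈ D.syzygy.A s) :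
    ∃ c : D.syzygy.ι → MvPolynomial (Fin n) k,
    (∀ t, c t ∈ maxIdeal n k ^ (D.syzygy.deg s + 1 - D.syzygy.deg t)) ∧
      (∀ t, s ≤ t → c t = 0) ∧
      (X i : MvPolynomial (Fin n) k) • h.syzGen s = ∑ t, c t • h.syzGen t := by
  classical
  obtain ⟨s, j⟩ := s
  obtain ⟨hiA, hij⟩ : i ∈ D.A s ∧ i < j.1 := by simpa [LinearData.syzygy] using hi
  set s₁ : D.syzygy.ι := ⟨s, j⟩
  set s₂ : D.syzygy.ι := ⟨s, ⟨i, hiA⟩⟩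
  have hlt : s₂ < s₁ := LinearData.syzygy_lt_iff.2 (Or.inr ⟨rfl, hij⟩)
  set z : D.ι → MvPolynomial (Fin n) k :=
    (X i : MvPolynomial (Fin n) k) • h.syzVec s₁ - (X j.1 : MvPolynomial (Fin n) k) • h.syzVec s₂
    with hzdef
  have hz1 : z ∈ syzygies k e := by
    exact Submodule.sub_mem _ (Submodule.smul_mem _ _ (h.syzVec_mem_syzygies _))
      (Submodule.smul_mem _ _ (h.syzVec_mem_syzygies _))
  have hz2 : ∀ t, z t ∈ maxIdeal n k ^ (D.deg s + 2 - D.deg t) := by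
    intro t
    have key : ∀ (l : Fin n) (s' : D.syzygy.ι), s'.1 = s →
        (X l : MvPolynomial (Fin n) k) * h.syzVec s' t ∈ maxIdeal n k ^ (D.deg s + 2 - D.deg t) := by
      intro l s' hs'
      refine Ideal.pow_le_pow_right ?_ (pow_succ' (maxIdeal n k) _ ▸
        Ideal.mul_mem_mul (X_mem_maxIdeal l) (h.syzVec_mem s' t))
      rw [hs']
      omega
    exact Ideal.sub_mem _ (key _ _ rfl) (key _ _ rfl)
  have hz3 : ∀ t : D.ι, (s : WithTop D.ι) ≤ t → z t = 0 := by
    intro t hst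
    rw [WithTop.coe_le_coe] at hst
    rcases hst.eq_or_lt with rfl | hlt
    · have h1 := h.syzVec_self s₁
      have h2 := h.syzVec_self s₂
      simp only [s₁, s₂] at h1 h2
      simp only [hzdef, Pi.sub_apply, Pi.smul_apply, smul_eq_mul, s₁, s₂, h1, h2]
      ring
    · simp [hzdef, h.syzVec_of_lt (s := s₁) hlt, h.syzVec_of_lt (s := s₂) hlt]
  -- `D.deg s + 2` is the degree of the S-pair: one for the linear syzygy, one for the extra
  -- variable.
  obtain ⟨b, hb, hbs, hbz⟩ := h.exists_eq_sum_syzVec s (D.deg s + 2) z hz1 hz2 hz3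
  refine ⟨b + Pi.single s₂ (X j.1), ?_, ?_, ?_⟩
  · intro t
    refine Ideal.add_mem _ (hb t) ?_
    by_cases ht : t = s₂
    · subst ht
      have : D.syzygy.deg s₁ + 1 - D.syzygy.deg s₂ = 1 := by
        change D.deg s + 1 + 1 - (D.deg s + 1) = 1
        omega
      rw [this, pow_one, Pi.single_eq_same]
      exact X_mem_maxIdeal _
    · rw [Pi.single_eq_of_ne ht]
      exact Ideal.zero_mem _
  · intro t ht
    have h1 : s ≤ t.1 := by
      rcases LinearData.syzygy_le_iff.1 ht with h | h
      exacts [h.le, h.1.le]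
    rw [Pi.add_apply, hbs t (WithTop.coe_le_coe.2 h1), Pi.single_eq_of_ne (hlt.trans_le ht).ne',
      add_zero]
  · apply Subtype.ext
    have h2 : ∑ t, (b + Pi.single s₂ (X j.1) : D.syzygy.ι → MvPolynomial (Fin n) k) t • h.syzVec t =
        z + (X j.1 : MvPolynomial (Fin n) k) • h.syzVec s₂ := by
      simp only [Pi.add_apply, add_smul, Finset.sum_add_distrib]
      rw [← hbz, Finset.sum_eq_single s₂]
      · simp
      · intro t _ ht
        simp [Pi.single_eq_of_ne ht]
      · simp
    have h3 (c : D.syzygy.ι → MvPolynomial (Fin n) k) : ((∑ t, c t • h.syzGen t : syzygies k e) :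
        D.ι → MvPolynomial (Fin n) k) = ∑ t, c t • h.syzVec t := by
      simp [syzGen]
    rw [h3, h2, hzdef]
    simp [syzGen]

/-- At entry `s`, the linear syzygies over earlier generators vanish and those over later ones have
coefficient zero. What remains is a relation among the variables `x_l`, `l ∈ A s`. -/
lemma syzGen_ann (c : D.syzygy.ι → MvPolynomial (Fin n) k) (s : D.syzygy.ι)
    (hcs : ∀ t, s < t → c t = 0) (hc : ∑ t, c t • h.syzGen t = 0) :
    c s ∈ Ideal.span (X '' (D.syzygy.A s : Set (Fin n))) := by
  classical
  obtain ⟨s, j⟩ := s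
  have h1 : ∑ t, c t • h.syzVec t = 0 := by
    have := congrArg (Subtype.val) hc
    simpa [syzGen] using this
  have h2 : ∑ t, c t * h.syzVec t s = 0 := by
    have := congrFun h1 s
    simpa [Finset.sum_apply] using this
  have h3 : ∑ l : D.A s, c ⟨s, l⟩ * X l.1 = 0 := by
    rw [← h2]
    refine Eq.trans ?_ (Fintype.sum_sigma _).symm
    rw [Finset.sum_eq_single s]
    · exact Finset.sum_congr rfl fun l _ => by rw [h.syzVec_self ⟨s, l⟩]
    · intro t _ hts
      refine Finset.sum_eq_zero fun l _ => ?_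
      rcases lt_or_gt_of_ne hts with hlt | hgt
      · rw [h.syzVec_of_lt (s := (⟨t, l⟩ : D.syzygy.ι)) hlt, mul_zero]
      · rw [hcs ⟨t, l⟩ (LinearData.syzygy_lt_iff.2 (Or.inl hgt)), zero_mul]
    · simp
  set c' : Fin n → MvPolynomial (Fin n) k := fun l => if hl : l ∈ D.A s then c ⟨s, ⟨l, hl⟩⟩ else 0
    with hc'
  have h4 : c' j.1 = c ⟨s, j⟩ := by simp [hc']
  rw [← h4]
  refine mem_span_X_of_sum_eq_zero j.2 ?_ ?_
  · intro i hi
    simp only [hc']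
    split_ifs with hl
    · exact hcs _ (LinearData.syzygy_lt_iff.2 (Or.inr ⟨rfl, hi⟩))
    · rfl
  · rw [← Finset.sum_coe_sort, ← h3]
    exact Finset.sum_congr rfl fun l _ => by simp [hc']

theorem syzygy : LinearPresentation (k := k) D.syzygy (syzygies k e) h.syzGen where
  monotone_deg := by
    intro s t hst
    have : s.1 ≤ t.1 := by
      rcases LinearData.syzygy_le_iff.1 hst with h | h
      exacts [h.le, h.1.le]
    exact Nat.succ_le_succ (h.monotone_deg this)
  span_eq_top := h.span_syzGen
  rel := h.syzGen_rel
  ann := h.syzGen_ann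

include h in
-- Minimality of the cover: monotone degrees make the exponent in `syzVec_mem` at least one wherever
-- the entry can be nonzero.
lemma syzygies_apply_mem (z : syzygies k e) (t : D.ι) : z.1 t ∈ maxIdeal n k := by
  obtain ⟨b, -, -, hb⟩ := h.exists_eq_sum_syzVec ⊤ 0 z.1 z.2 (by simp) (by simp)
  rw [hb, Finset.sum_apply]
  refine Ideal.sum_mem _ fun s _ => Ideal.mul_mem_left _ _ ?_
  by_cases hst : s.1 < t
  · simp [h.syzVec_of_lt hst]
  · have := h.monotone_deg (not_lt.1 hst)
    exact Ideal.pow_le_self (by omega) (h.syzVec_mem s t)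

end LinearPresentation

/-! ### The minimal resolution of the quotient by an ideal with linear quotients -/

variable (n k) in
/-- A module with a linear presentation. -/
structure LinearModule where
  data : LinearData n
  carrier : Type u
  addCommGroup : AddCommGroup carrier
  module : Module (MvPolynomial (Fin n) k) carrier
  gen : data.ι → carrier
  isPresentation : LinearPresentation (k := k) data carrier gen

namespace LinearModule

attribute [instance] LinearModule.addCommGroup LinearModule.module

/-- The first syzygy module of a module with a linear presentation. -/
def syzygy (S : LinearModule n k) : LinearModule n k where
  data := S.data.syzygy
  carrier := LinearPresentation.syzygies k S.gen
  addCommGroup := inferInstance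
  module := inferInstance
  gen := S.isPresentation.syzGen
  isPresentation := S.isPresentation.syzygy

/-- The `p`-th syzygy module of a module with a linear presentation. -/
def iterSyzygy (S : LinearModule n k) : ℕ → LinearModule n k
  | 0 => S
  | p + 1 => (S.iterSyzygy p).syzygy

lemma data_iterSyzygy (S : LinearModule n k) (p : ℕ) :
    (S.iterSyzygy p).data = S.data.iterSyzygy p := by
  induction p with
  | zero => rfl
  | succ p ih => exact congrArg LinearData.syzygy ih

lemma linearCombination_surjective (S : LinearModule n k) :
    Function.Surjective (Fintype.linearCombination (MvPolynomial (Fin n) k) S.gen) := by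
  rw [← LinearMap.range_eq_top, Fintype.range_linearCombination, S.isPresentation.span_eq_top]

end LinearModule

section Ideal

variable (J : Ideal (MvPolynomial (Fin n) k)) (hJ : J ≤ maxIdeal n k) {D : LinearData n} {e : D.ι → J}
  (h : LinearPresentation (k := k) D J e)

/-- An ideal with a linear presentation, as a `LinearModule`. -/
def LinearPresentation.linearModule : LinearModule n k where
  data := D
  carrier := J
  addCommGroup := inferInstance
  module := inferInstance
  gen := e
  isPresentation := h

/-- The syzygies of `R ⧸ J` for an ideal `J ≤ 𝔪` with a linear presentation. -/
def LinearPresentation.minimalSyzygies : MinimalSyzygies (n := n) (k := k)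
    (MvPolynomial (Fin n) k ⧸ J) where
  -- The indices shift by one: `R → R/J` is the cover in degree 0, so the `p`-th syzygy module of
  -- `J` is the `(p + 1)`-st of `R/J`.
  syz
    | 0 => ModuleCat.of _ (MvPolynomial (Fin n) k ⧸ J)
    | p + 1 => ModuleCat.of _ ((h.linearModule J).iterSyzygy p).carrier
  ι
    | 0 => Unit
    | p + 1 => ((h.linearModule J).iterSyzygy p).data.ι
  fintype
    | 0 => inferInstanceAs (Fintype Unit)
    | p + 1 => ((h.linearModule J).iterSyzygy p).data.fintype
  cover
    | 0 => J.mkQ ∘ₗ LinearMap.proj ()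
    | p + 1 => Fintype.linearCombination _ ((h.linearModule J).iterSyzygy p).gen
  cover_surjective
    | 0 => J.mkQ_surjective.comp fun x => ⟨fun _ => x, rfl⟩
    | p + 1 => ((h.linearModule J).iterSyzygy p).linearCombination_surjective
  incl
    | 0 => LinearMap.pi (fun _ => J.subtype)
    | p + 1 => (LinearPresentation.syzygies k ((h.linearModule J).iterSyzygy p).gen).subtype
  incl_injective
    | 0 => fun x y hxy => Subtype.ext (congrFun hxy ())
    | p + 1 => Subtype.val_injective
  range_incl
    | 0 => by
      ext x
      refine ⟨?_, fun hx => ?_⟩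
      · rintro ⟨y, rfl⟩
        exact (Submodule.Quotient.mk_eq_zero J).2 y.2
      · exact ⟨⟨x (), (Submodule.Quotient.mk_eq_zero J).1 hx⟩, rfl⟩
    | p + 1 => Submodule.range_subtype _
  incl_mem
    | 0 => fun x _ => hJ x.2
    | p + 1 => fun x i => ((h.linearModule J).iterSyzygy p).isPresentation.syzygies_apply_mem x i
  base := LinearEquiv.refl _ _

include hJ h in
theorem LinearPresentation.totalBetti_quotient (p : ℕ) :
    totalBetti (n := n) (k := k) (p + 1) (MvPolynomial (Fin n) k ⧸ J) =
      ((∑ s : D.ι, (D.A s).card.choose p : ℕ) : Cardinal) := by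
  rw [(h.minimalSyzygies J hJ).totalBetti_eq, ← D.card_iterSyzygy]
  have h2 := (h.linearModule J).data_iterSyzygy p
  congr 1
  change Fintype.card ((h.linearModule J).iterSyzygy p).data.ι = _
  rw [h2]
  rfl

end Ideal

/-! ### Strongly stable ideals have linear quotients -/

section Combinatorics

/-- Strongly stable sets of exponent vectors. -/
structure IsStableSet (L : Set (Fin n →₀ ℕ)) : Prop where
  isUpperSet : IsUpperSet L
  move : ∀ a ∈ L, ∀ i, 1 ≤ a i → ∀ j < i, a - Finsupp.single i 1 + Finsupp.single j 1 ∈ L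

/-- The exponent vectors of the minimal monomial generators. -/
def minGens (L : Set (Fin n →₀ ℕ)) : Set (Fin n →₀ ℕ) := {a | Minimal (· ∈ L) a}

lemma exists_minGens_le {L : Set (Fin n →₀ ℕ)} {a : Fin n →₀ ℕ} (ha : a ∈ L) :
    ∃ g ∈ minGens L, g ≤ a := by
  obtain ⟨g, hga, hg⟩ := exists_minimal_le_of_wellFoundedLT (· ∈ L) a ha
  exact ⟨g, hg, hga⟩

lemma degree_eq_sum_univ (a : Fin n →₀ ℕ) : a.degree = ∑ i, a i :=
  Finsupp.degree_eq_sum a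

lemma monomial_mem_monomialSpan {L : Set (Fin n →₀ ℕ)} (hL : IsUpperSet L) {a : Fin n →₀ ℕ} :
    monomial a (1 : k) ∈ monomialSpan k L ↔ a ∈ L := by
  classical
  rw [monomialSpan, mem_ideal_span_monomial_image]
  simp only [support_monomial, one_ne_zero, if_false, Finset.mem_singleton, forall_eq]
  exact ⟨fun ⟨b, hb, hba⟩ => hL hba hb, fun ha => ⟨a, ha, le_rfl⟩⟩

lemma monomialSpan_minGens (L : Set (Fin n →₀ ℕ)) :
    monomialSpan k (minGens L) = monomialSpan k L := by
  apply le_antisymm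
  · exact Ideal.span_mono (Set.image_mono fun a ha => ha.1)
  · rw [monomialSpan, Ideal.span_le]
    rintro _ ⟨a, ha, rfl⟩
    obtain ⟨g, hg, hga⟩ := exists_minGens_le ha
    refine (mem_ideal_span_monomial_image (R := k)).2 fun x hx => ?_
    have := support_monomial_subset hx
    rw [Finset.mem_singleton] at this
    exact ⟨g, hg, this ▸ hga⟩

/-- As long as `a` does not divide `b`, it has excess at some `i ≥ m` and, by degree, a deficit at
some `j ≤ m`. Moving one unit from `i` to `j` is allowed by stability and lowers the total excess.
-/
lemma IsStableSet.mem_of_le {L : Set (Fin n →₀ ℕ)} (hL : IsStableSet L) {m : Fin n}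
    {a b : Fin n →₀ ℕ} (ha : a ∈ L) (hbm : ∀ i, m < i → b i = 0) (hab : ∀ i < m, a i ≤ b i)
    (hdeg : a.degree ≤ b.degree) : b ∈ L := by
  induction hN : ∑ i, (a i - b i) using Nat.strong_induction_on generalizing a with
  | _ N ih =>
  by_cases hle : a ≤ b
  · exact hL.isUpperSet hle ha
  obtain ⟨i, hi⟩ : ∃ i, b i < a i := by
    by_contra! hcon
    exact hle hcon
  have hmi : m ≤ i := by
    by_contra! hcon
    exact absurd (hab i hcon) (not_le.2 hi)
  obtain ⟨j, hj⟩ : ∃ j, a j < b j := by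
    by_contra! hcon
    rw [degree_eq_sum_univ, degree_eq_sum_univ] at hdeg
    exact absurd hdeg (not_le.2 (Finset.sum_lt_sum (fun x _ => hcon x) ⟨i, Finset.mem_univ i, hi⟩))
  have hjm : j ≤ m := by
    by_contra! hcon
    rw [hbm j hcon] at hj
    omega
  have hij : j ≠ i := by rintro rfl; omega
  have hji : j < i := lt_of_le_of_ne (hjm.trans hmi) hij
  have hval : ∀ l, (a - Finsupp.single i 1 + Finsupp.single j 1 : Fin n →₀ ℕ) l =
      a l - (if l = i then 1 else 0) + if l = j then 1 else 0 := fun l => by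
    simp [Finsupp.single_apply, eq_comm]
  refine ih _ ?_ (hL.move a ha i (by omega) j hji) ?_ ?_ rfl
  · rw [← hN]
    refine Finset.sum_lt_sum (fun l _ => ?_) ⟨i, Finset.mem_univ i, ?_⟩
    · rw [hval]
      by_cases h1 : l = j
      · subst h1; simp only [if_true, if_neg hij]; omega
      · simp only [if_neg h1]; split_ifs <;> omega
    · rw [hval, if_pos rfl, if_neg hij.symm]
      omega
  · intro l hl
    rw [hval]
    have := hab l hl
    by_cases h1 : l = j
    · subst h1; simp only [if_true, if_neg hij]; omega
    · simp only [if_neg h1]; split_ifs <;> omega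
  · have h1 : a - Finsupp.single i 1 + Finsupp.single i 1 = a :=
      tsub_add_cancel_of_le (by rw [Finsupp.single_le_iff]; omega)
    have h2 := congrArg Finsupp.degree h1
    rw [map_add, Finsupp.degree_single] at h2
    rw [map_add, Finsupp.degree_single]
    omega

/-- The variables preceding the largest variable in the monomial `x ^ a`. -/
def belowMax (a : Fin n →₀ ℕ) : Finset (Fin n) :=
  Finset.univ.filter fun j => ∃ i, j < i ∧ a i ≠ 0

lemma mem_belowMax {a : Fin n →₀ ℕ} {j : Fin n} : j ∈ belowMax a ↔ ∃ i, j < i ∧ a i ≠ 0 := by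
  simp [belowMax]

/-- The order by degree, then reverse lexicographic. -/
def degRevLex (a : Fin n →₀ ℕ) : ℕ ×ₗ Lex ((Fin n)ᵒᵈ → ℕ) :=
  toLex (a.degree, toLex fun i => a (OrderDual.ofDual i))

lemma degRevLex_injective : Function.Injective (degRevLex (n := n)) := by
  intro a b h
  have h2 := congrArg (fun x => ofLex (ofLex x).2) h
  ext i
  exact congrFun h2 (OrderDual.toDual i)

lemma degRevLex_lt_iff {a b : Fin n →₀ ℕ} : degRevLex a < degRevLex b ↔
    a.degree < b.degree ∨ a.degree = b.degree ∧ ∃ i, (∀ l, i < l → a l = b l) ∧ a i < b i :=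
  Prod.Lex.toLex_lt_toLex

lemma degree_le_of_degRevLex_le {a b : Fin n →₀ ℕ} (h : degRevLex a ≤ degRevLex b) :
    a.degree ≤ b.degree := by
  rcases Prod.Lex.toLex_le_toLex.1 h with h | h
  exacts [h.le, h.1.le]

/-- The data of the ideal generated by a strongly stable set of monomials. -/
def stableData (L : Set (Fin n →₀ ℕ)) [Fintype (minGens L)] : LinearData n where
  ι := minGens L
  fintype := inferInstance
  linearOrder := LinearOrder.lift' (fun a => degRevLex a.1)
    (degRevLex_injective.comp Subtype.val_injective)
  deg a := a.1.degree
  A a := belowMax a.1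

variable {L : Set (Fin n →₀ ℕ)}

lemma exists_max_of_ne {a : Fin n →₀ ℕ} {i : Fin n} (hi : a i ≠ 0) :
    ∃ m, i ≤ m ∧ a m ≠ 0 ∧ ∀ l, m < l → a l = 0 := by
  obtain ⟨m, hm, hmax⟩ := Finset.exists_max_image a.support id ⟨i, by simpa using hi⟩
  refine ⟨m, hmax i (by simpa using hi), by simpa using hm, fun l hl => ?_⟩
  by_contra hcon
  exact absurd (hmax l (by simpa using hcon)) (not_le.2 hl)

/-- Linear quotients, first half: `x_j u` is a multiple of an earlier generator. -/
lemma IsStableSet.exists_lt_le_add_single (hL : IsStableSet L) {a : Fin n →₀ ℕ} (ha : a ∈ minGens L)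
    {j : Fin n} (hj : j ∈ belowMax a) :
    ∃ g ∈ minGens L, degRevLex g < degRevLex a ∧ g ≤ a + Finsupp.single j 1 := by
  obtain ⟨i, hji, hi⟩ := mem_belowMax.1 hj
  obtain ⟨m, him, hm, hmax⟩ := exists_max_of_ne hi
  have hjm := hji.trans_le him
  -- With `x_m` the largest variable of `x^a`, the monomial `x_j x^a / x_m` has the same degree,
  -- divides `x_j x^a` and has a smaller exponent at `m`. A minimal generator dividing it therefore
  -- precedes `a`.
  obtain ⟨g, hg, hga⟩ := exists_minGens_le (hL.move a ha.1 m (Nat.one_le_iff_ne_zero.2 hm) j hjm)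
  refine ⟨g, hg, ?_, hga.trans (by gcongr; exact tsub_le_self)⟩
  have hdeg : (a - Finsupp.single m 1 + Finsupp.single j 1).degree = a.degree := by
    have h1 : a - Finsupp.single m 1 + Finsupp.single m 1 = a :=
      tsub_add_cancel_of_le (by rw [Finsupp.single_le_iff]; omega)
    have h2 := congrArg Finsupp.degree h1
    rw [map_add, Finsupp.degree_single] at h2
    rw [map_add, Finsupp.degree_single, h2]
  have hle := Finsupp.degree_mono hga
  rw [hdeg] at hle
  rw [degRevLex_lt_iff]
  rcases hle.lt_or_eq with h | h
  · exact Or.inl h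
  refine Or.inr ⟨h, m, fun l hl => ?_, ?_⟩
  · have := hga l
    simp only [Finsupp.add_apply, Finsupp.tsub_apply, hmax l hl,
      Finsupp.single_eq_of_ne (hjm.trans hl).ne'] at this
    rw [hmax l hl]
    omega
  · have := hga m
    simp only [Finsupp.add_apply, Finsupp.tsub_apply, Finsupp.single_eq_same,
      Finsupp.single_eq_of_ne hjm.ne'] at this
    omega

/-- Linear quotients, second half. -/
lemma IsStableSet.exists_mem_belowMax_of_le_add (hL : IsStableSet L) {s t w : Fin n →₀ ℕ}
    (hs : s ∈ minGens L) (ht : t ∈ minGens L) (hts : degRevLex t < degRevLex s) (h : t ≤ w + s) :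
    ∃ i ∈ belowMax s, w i ≠ 0 := by
  by_contra! hcon
  by_cases hs0 : s = 0
  · subst hs0
    rw [ht.eq_of_le hs.1 zero_le] at hts
    exact lt_irrefl _ hts
  obtain ⟨i, hi⟩ := Finsupp.ne_iff.1 hs0
  obtain ⟨m, -, hm, hmax⟩ := exists_max_of_ne hi
  have hle : ∀ l < m, t l ≤ s l := fun l hl => by
    have := h l
    rwa [Finsupp.add_apply, hcon l (mem_belowMax.2 ⟨m, hl, hm⟩), zero_add] at this
  -- In lower degree, `mem_of_le` puts `x^s / x_m` in `L`, against the minimality of `s`. In equal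
  -- degree, `t ≤ s` everywhere with a strict inequality at `i`, against the equality of degrees.
  rcases degRevLex_lt_iff.1 hts with hdeg | ⟨hdeg, i, hil, hlt⟩
  · have h1 : s - Finsupp.single m 1 + Finsupp.single m 1 = s :=
      tsub_add_cancel_of_le (by rw [Finsupp.single_le_iff]; omega)
    have h2 := congrArg Finsupp.degree h1
    rw [map_add, Finsupp.degree_single] at h2
    have hmem : s - Finsupp.single m 1 ∈ L := by
      refine hL.mem_of_le (m := m) ht.1 (fun l hl => by simp [hmax l hl]) (fun l hl => ?_) (by omega)
      simpa [Finsupp.single_eq_of_ne hl.ne] using hle l hl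
    have h3 := hs.eq_of_le hmem tsub_le_self
    have h4 := congrArg Finsupp.degree h3
    omega
  · have him : i ≤ m := by
      by_contra! hmi
      rw [hmax i hmi] at hlt
      omega
    rw [degree_eq_sum_univ, degree_eq_sum_univ] at hdeg
    refine absurd hdeg (Finset.sum_lt_sum (fun l _ => ?_) ⟨i, Finset.mem_univ i, hlt⟩).ne
    rcases lt_trichotomy l i with h1 | rfl | h1
    · exact hle l (h1.trans_le him)
    · exact hlt.le
    · exact (hil l h1).le

/-- The monomial generators of a monomial ideal. -/
def monomialGen (k : Type u) [Field k] (L : Set (Fin n →₀ ℕ)) (a : minGens L) : monomialSpan k L :=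
  ⟨monomial a.1 1, Ideal.subset_span ⟨a.1, a.2.1, rfl⟩⟩

lemma span_range_monomialGen (L : Set (Fin n →₀ ℕ)) :
    Submodule.span (MvPolynomial (Fin n) k) (Set.range (monomialGen k L)) = ⊤ := by
  have key : Set.range ((monomialSpan k L).subtype ∘ monomialGen k L) =
      (fun a => monomial a (1 : k)) '' minGens L := by
    rw [Set.image_eq_range]
    rfl
  apply Submodule.map_injective_of_injective (Submodule.injective_subtype _)
  rw [Submodule.map_span, ← Set.range_comp, Submodule.map_top, Submodule.range_subtype, key]
  exact monomialSpan_minGens L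

lemma IsStableSet.monomialGen_rel (hL : IsStableSet L) [Fintype (minGens L)] (s : minGens L)
    {j : Fin n} (hj : j ∈ belowMax s.1) :
    ∃ c : minGens L → MvPolynomial (Fin n) k,
      (∀ t, c t ∈ maxIdeal n k ^ (s.1.degree + 1 - t.1.degree)) ∧
      (∀ t, degRevLex s.1 ≤ degRevLex t.1 → c t = 0) ∧
      (X j : MvPolynomial (Fin n) k) • monomialGen k L s = ∑ t, c t • monomialGen k L t := by
  classical
  obtain ⟨g, hg, hgs, hgle⟩ := hL.exists_lt_le_add_single s.2 hj
  refine ⟨Pi.single (⟨g, hg⟩ : minGens L) (monomial (s.1 + Finsupp.single j 1 - g) 1), ?_, ?_, ?_⟩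
  · intro t
    by_cases ht : t = (⟨g, hg⟩ : minGens L)
    · subst ht
      rw [Pi.single_eq_same]
      refine (monomial_mem_pow_idealOfVars_iff _ _ one_ne_zero).2 ?_
      have h2 := congrArg Finsupp.degree (tsub_add_cancel_of_le hgle)
      rw [map_add, map_add, Finsupp.degree_single] at h2
      dsimp only
      omega
    · rw [Pi.single_eq_of_ne ht]
      exact Ideal.zero_mem _
  · intro t hst
    refine Pi.single_eq_of_ne ?_ _
    rintro rfl
    exact absurd hgs (not_lt.2 hst)
  · apply Subtype.ext
    rw [Finset.sum_eq_single (⟨g, hg⟩ : minGens L)]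
    · rw [Pi.single_eq_same]
      change X j * monomial s.1 (1 : k) =
        monomial (s.1 + Finsupp.single j 1 - g) 1 * monomial g (1 : k)
      rw [monomial_mul, tsub_add_cancel_of_le hgle, X, monomial_mul, add_comm]
    · intro t _ ht
      rw [Pi.single_eq_of_ne ht, zero_smul]
    · exact fun h => absurd (Finset.mem_univ _) h

/-- For a term `x^w` of `c s`, the monomial `x^(w + s)` must be cancelled by another generator `t`.
It precedes `s` and divides `x^(w + s)`, so some variable of `x^w` lies below the largest one of
`x^s`. -/
lemma IsStableSet.monomialGen_ann (hL : IsStableSet L) [Fintype (minGens L)]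
    (c : minGens L → MvPolynomial (Fin n) k) (s : minGens L)
    (hcs : ∀ t, degRevLex s.1 < degRevLex t.1 → c t = 0)
    (hc : ∑ t, c t • monomialGen k L t = 0) :
    c s ∈ Ideal.span (X '' (belowMax s.1 : Set (Fin n))) := by
  classical
  have hc' : ∑ t : minGens L, c t * monomial t.1 (1 : k) = 0 := by
    have := congrArg Subtype.val hc
    simpa [monomialGen] using this
  rw [mem_ideal_span_X_image]
  intro w hw
  have h0 := congrArg (coeff (w + s.1)) hc'
  rw [coeff_sum, coeff_zero] at h0
  obtain ⟨t, hts, ht⟩ : ∃ t : minGens L, t ≠ s ∧ coeff (w + s.1) (c t * monomial t.1 1) ≠ 0 := by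
    by_contra! hcon
    rw [Finset.sum_eq_single s (fun t _ hts => hcon t hts) (by simp), coeff_mul_monomial,
      mul_one] at h0
    exact mem_support_iff.1 hw h0
  rw [coeff_mul_monomial'] at ht
  have hle : t.1 ≤ w + s.1 := by
    by_contra hcon
    exact ht (if_neg hcon)
  have hlt : degRevLex t.1 < degRevLex s.1 := by
    by_contra hcon
    have h1 : degRevLex s.1 < degRevLex t.1 :=
      lt_of_le_of_ne (not_lt.1 hcon) fun h => hts (Subtype.ext (degRevLex_injective h.symm))
    exact ht (by rw [hcs t h1]; simp)
  exact hL.exists_mem_belowMax_of_le_add s.2 t.2 hlt hle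

theorem IsStableSet.linearPresentation (hL : IsStableSet L) [Fintype (minGens L)] :
    LinearPresentation (k := k) (stableData L) (monomialSpan k L) (monomialGen k L) where
  monotone_deg := fun _ _ h => degree_le_of_degRevLex_le h
  span_eq_top := span_range_monomialGen L
  rel := fun s _ hj => hL.monomialGen_rel s hj
  ann := fun c s => hL.monomialGen_ann c s

/-- The Eliahou-Kervaire formula for the Betti numbers of a strongly stable ideal. -/
theorem IsStableSet.totalBetti_quotient (hL : IsStableSet L) [Fintype (minGens L)] (h0 : 0 ∉ L)
    (p : ℕ) :
    totalBetti (n := n) (k := k) (p + 1) (MvPolynomial (Fin n) k ⧸ monomialSpan k L) =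
      ((∑ a : minGens L, (belowMax a.1).card.choose p : ℕ) : Cardinal) := by
  refine LinearPresentation.totalBetti_quotient _ ?_ hL.linearPresentation p
  rw [monomialSpan, Ideal.span_le]
  rintro _ ⟨a, ha, rfl⟩
  have := (monomial_mem_pow_idealOfVars_iff (R := k) 1 a one_ne_zero).2
    (Nat.one_le_iff_ne_zero.2 fun h => h0 (((Finsupp.degree_eq_zero_iff a).1 h) ▸ ha))
  rwa [pow_one] at this

end Combinatorics

/-! ### Counting monomials of degree d by largest variable -/

section Count

lemma belowMax_eq_Iio {a : Fin n →₀ ℕ} {m : Fin n} (hm : a m ≠ 0) (hmax : ∀ l, m < l → a l = 0) :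
    belowMax a = Finset.Iio m := by
  ext j
  rw [mem_belowMax, Finset.mem_Iio]
  refine ⟨fun ⟨i, hji, hi⟩ => ?_, fun h => ⟨m, h, hm⟩⟩
  by_contra hcon
  exact hi (hmax i ((not_lt.1 hcon).trans_lt hji))

lemma mem_finsuppAntidiag_univ {d : ℕ} {a : Fin n →₀ ℕ} :
    a ∈ Finset.finsuppAntidiag Finset.univ d ↔ a.degree = d := by
  rw [Finset.mem_finsuppAntidiag, degree_eq_sum_univ]
  simp

/-- Summation over the monomials of degree `d` by their largest variable. -/
lemma sum_choose_card_belowMax {d : ℕ} (hd : 1 ≤ d) (p : ℕ) :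
    ∑ a ∈ Finset.finsuppAntidiag (Finset.univ : Finset (Fin n)) d, (belowMax a).card.choose p =
      ∑ i ∈ Finset.Icc 1 n, (d + i - 2).choose (d - 1) * (i - 1).choose p := by
  classical
  have hmem : ∀ (i : Fin n) (a : Fin n →₀ ℕ),
      a ∈ Finset.finsuppAntidiag (Finset.Iic i) (d - 1) →
      (a + Finsupp.single i 1 : Fin n →₀ ℕ) i ≠ 0 ∧
        (∀ l, i < l → (a + Finsupp.single i 1 : Fin n →₀ ℕ) l = 0) ∧
        (a + Finsupp.single i 1).degree = d := by
    intro i a ha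
    rw [Finset.mem_finsuppAntidiag] at ha
    have h0 : ∀ l, i < l → a l = 0 := fun l hl => by
      by_contra hcon
      exact absurd (Finset.mem_Iic.1 (ha.2 (Finsupp.mem_support_iff.2 hcon))) (not_le.2 hl)
    refine ⟨by simp, fun l hl => by simp [h0 l hl, Finsupp.single_eq_of_ne hl.ne'], ?_⟩
    have h1 : ∑ l, a l = d - 1 := by
      rw [← ha.1]
      refine (Finset.sum_subset (Finset.subset_univ _) fun l _ hl => h0 l ?_).symm
      simpa using hl
    rw [map_add, Finsupp.degree_single, degree_eq_sum_univ, h1]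
    omega
  have h1 : ∑ a ∈ Finset.finsuppAntidiag (Finset.univ : Finset (Fin n)) d,
      (belowMax a).card.choose p =
      ∑ x ∈ (Finset.univ : Finset (Fin n)).sigma
        (fun i => Finset.finsuppAntidiag (Finset.Iic i) (d - 1)), x.1.1.choose p := by
    symm
    -- A monomial with largest variable `x_i` is `x_i` times an arbitrary monomial of degree `d - 1`
    -- in the variables up to `x_i`.
    refine Finset.sum_bij (fun x _ => x.2 + Finsupp.single x.1 1) ?_ ?_ ?_ ?_
    · rintro ⟨i, a⟩ hx
      exact mem_finsuppAntidiag_univ.2 (hmem i a (Finset.mem_sigma.1 hx).2).2.2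
    · rintro ⟨i, a⟩ hx ⟨j, b⟩ hy hxy
      obtain ⟨h1, h2, -⟩ := hmem i a (Finset.mem_sigma.1 hx).2
      obtain ⟨h3, h4, -⟩ := hmem j b (Finset.mem_sigma.1 hy).2
      dsimp only at hxy
      obtain rfl : i = j := by
        rcases lt_trichotomy i j with h | h | h
        · exact absurd (hxy ▸ h2 j h) h3
        · exact h
        · exact absurd (hxy ▸ h4 i h) h1
      rw [add_right_cancel hxy]
    · intro a ha
      rw [mem_finsuppAntidiag_univ] at ha
      obtain ⟨i, hi⟩ : ∃ i, a i ≠ 0 := by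
        by_contra! hcon
        rw [degree_eq_sum_univ, Finset.sum_eq_zero fun i _ => hcon i] at ha
        omega
      obtain ⟨m, -, hm, hmax⟩ := exists_max_of_ne hi
      have h1 : a - Finsupp.single m 1 + Finsupp.single m 1 = a :=
        tsub_add_cancel_of_le (by rw [Finsupp.single_le_iff]; omega)
      refine ⟨⟨m, a - Finsupp.single m 1⟩, ?_, h1⟩
      have h2 := congrArg Finsupp.degree h1
      rw [map_add, Finsupp.degree_single, ha, degree_eq_sum_univ] at h2
      rw [Finset.mem_sigma, Finset.mem_finsuppAntidiag]
      have h3 : ∀ l, l ∉ Finset.Iic m → (a - Finsupp.single m 1 : Fin n →₀ ℕ) l = 0 := fun l hl => by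
        rw [Finset.mem_Iic, not_le] at hl
        simp [hmax l hl]
      refine ⟨Finset.mem_univ _, ?_, fun l hl => ?_⟩
      · dsimp only
        rw [Finset.sum_subset (Finset.subset_univ _) fun l _ hl => h3 l hl]
        omega
      · by_contra hcon
        exact Finsupp.mem_support_iff.1 hl (h3 l hcon)
    · rintro ⟨i, a⟩ hx
      obtain ⟨h1, h2, -⟩ := hmem i a (Finset.mem_sigma.1 hx).2
      dsimp only
      rw [belowMax_eq_Iio h1 h2, Fin.card_Iio]
  rw [h1, Finset.sum_sigma]
  simp only [Finset.sum_const, Finset.card_finsuppAntidiag_nat_eq_choose, Fin.card_Iic,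
    smul_eq_mul]
  -- Variables are indexed from 0 in `Fin n` and from 1 in the target sum.
  rw [Fin.sum_univ_eq_sum_range (fun i => (i + 1 + (d - 1) - 1).choose (d - 1) * i.choose p) n,
    show Finset.Icc 1 n = Finset.Ico 1 (n + 1) from rfl, Finset.sum_Ico_eq_sum_range,
    Nat.add_sub_cancel]
  refine Finset.sum_congr rfl fun i _ => ?_
  congr 2 <;> omega

lemma finrank_homogeneousSubmodule (k : Type u) [Field k] (d : ℕ) :
    Module.finrank k (homogeneousSubmodule (Fin n) k d) =
      (Finset.finsuppAntidiag (Finset.univ : Finset (Fin n)) d).card := by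
  rw [homogeneousSubmodule_eq_finsupp_supported,
    (AddMonoidAlgebra.supportedEquivFinsupp _).finrank_eq,
    Module.finrank_eq_nat_card_basis Finsupp.basisSingleOne, Nat.card_coe_set_eq,
    ← Set.ncard_coe_finset]
  congr 1
  ext a
  exact mem_finsuppAntidiag_univ.symm

end Count

/-! ### The bijection from monomials of degree d to minimal generators -/

section Extend

variable {N : ℕ} {d : ℕ} {L : Set (Fin (N + 1) →₀ ℕ)}

/-- Stable sets of monomials of degree at least `d` that contain all monomials of degree `d`
without the last variable, and a power of the last variable. -/
structure IsArtinianStable (L : Set (Fin (N + 1) →₀ ℕ)) (d : ℕ) : Prop extends IsStableSet L where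
  le_degree : ∀ a ∈ L, d ≤ a.degree
  mem_of_last : ∀ a : Fin (N + 1) →₀ ℕ, a.degree = d → a (Fin.last N) = 0 → a ∈ L
  exists_pow : ∃ q, Finsupp.single (Fin.last N) q ∈ L

lemma IsArtinianStable.exists_update_mem (hL : IsArtinianStable L d) (a : Fin (N + 1) →₀ ℕ) :
    ∃ q, a.update (Fin.last N) q ∈ L := by
  obtain ⟨q, hq⟩ := hL.exists_pow
  refine ⟨q, hL.isUpperSet ?_ hq⟩
  rw [Finsupp.single_le_iff]
  simp

open Classical in
/-- The least exponent of the last variable for which the monomial lies in `L`. -/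
def lastExp (hL : IsArtinianStable L d) (a : Fin (N + 1) →₀ ℕ) : ℕ :=
  Nat.find (hL.exists_update_mem a)

/-- Replace the exponent of the last variable by the least possible. -/
def toMinGen (hL : IsArtinianStable L d) (a : Fin (N + 1) →₀ ℕ) : Fin (N + 1) →₀ ℕ :=
  a.update (Fin.last N) (lastExp hL a)

variable (hL : IsArtinianStable L d)
include hL

lemma toMinGen_mem (a : Fin (N + 1) →₀ ℕ) : toMinGen hL a ∈ L := by
  classical
  exact Nat.find_spec (hL.exists_update_mem a)

lemma lastExp_le {a : Fin (N + 1) →₀ ℕ} {q : ℕ} (h : a.update (Fin.last N) q ∈ L) :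
    lastExp hL a ≤ q := by
  classical
  exact Nat.find_min' (hL.exists_update_mem a) h

lemma toMinGen_last (a : Fin (N + 1) →₀ ℕ) : toMinGen hL a (Fin.last N) = lastExp hL a := by
  simp [toMinGen]

lemma toMinGen_of_ne (a : Fin (N + 1) →₀ ℕ) {i : Fin (N + 1)} (hi : i ≠ Fin.last N) :
    toMinGen hL a i = a i := by
  simp [toMinGen, hi]

lemma degree_toMinGen (a : Fin (N + 1) →₀ ℕ) :
    (toMinGen hL a).degree + a (Fin.last N) = a.degree + lastExp hL a := by
  rw [degree_eq_sum_univ, degree_eq_sum_univ, Fin.sum_univ_castSucc, Fin.sum_univ_castSucc,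
    toMinGen_last, Finset.sum_congr rfl fun i _ => toMinGen_of_ne hL a (Fin.castSucc_lt_last i).ne]
  omega

/-- Lowering a positive last exponent to zero would give an element of `L` of degree below `d`.
Hence `toMinGen` preserves supports in degree `d`. -/
lemma lastExp_eq_zero_iff {a : Fin (N + 1) →₀ ℕ} (ha : a.degree = d) :
    lastExp hL a = 0 ↔ a (Fin.last N) = 0 := by
  constructor
  · intro h
    have h1 := degree_toMinGen hL a
    have h2 := hL.le_degree _ (toMinGen_mem hL a)
    omega
  · intro h
    refine Nat.le_zero.1 (lastExp_le hL ?_)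
    rw [← h, Finsupp.update_self]
    exact hL.mem_of_last a ha h

lemma belowMax_toMinGen {a : Fin (N + 1) →₀ ℕ} (ha : a.degree = d) :
    belowMax (toMinGen hL a) = belowMax a := by
  have h : ∀ i, toMinGen hL a i ≠ 0 ↔ a i ≠ 0 := by
    intro i
    by_cases hi : i = Fin.last N
    · rw [hi, toMinGen_last, not_iff_not, lastExp_eq_zero_iff hL ha]
    · rw [toMinGen_of_ne hL a hi]
  ext j
  simp only [mem_belowMax, h]

/-- Otherwise dividing by some `x_i` stays in `L`. For the last variable this contradicts the choice
of `lastExp`. For another one, either `lastExp` is zero and the degree drops below `d`, or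
exchanging the last variable for `x_i` restores the other exponents with a smaller last one. -/
lemma toMinGen_mem_minGens {a : Fin (N + 1) →₀ ℕ} (ha : a.degree = d) :
    toMinGen hL a ∈ minGens L := by
  refine ⟨toMinGen_mem hL a, fun b hb hba => ?_⟩
  by_contra hcon
  obtain ⟨i, hi⟩ : ∃ i, b i < toMinGen hL a i := by
    by_contra! h
    exact hcon h
  have hlast : ∀ c ∈ L, (∀ j ≠ Fin.last N, c j = a j) → lastExp hL a ≤ c (Fin.last N) := by
    intro c hc hca
    refine lastExp_le hL ?_
    convert hc using 1
    ext j
    by_cases hj : j = Fin.last N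
    · simp [hj]
    · simp [hj, hca j hj]
  have hsub : toMinGen hL a - Finsupp.single i 1 ∈ L := by
    refine hL.isUpperSet (fun j => ?_) hb
    have := hba j
    by_cases hj : j = i
    · subst hj
      simp only [Finsupp.tsub_apply, Finsupp.single_eq_same]
      omega
    · simpa [Finsupp.single_eq_of_ne hj] using this
  by_cases hil : i = Fin.last N
  · subst hil
    have := hlast _ hsub fun j hj => by
      simp [Finsupp.single_eq_of_ne hj, toMinGen_of_ne hL a hj]
    simp only [Finsupp.tsub_apply, Finsupp.single_eq_same, toMinGen_last] at this
    rw [toMinGen_last] at hi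
    omega
  · have h1 : toMinGen hL a - Finsupp.single i 1 + Finsupp.single i 1 = toMinGen hL a :=
      tsub_add_cancel_of_le (by rw [Finsupp.single_le_iff]; omega)
    have hlast_i : (toMinGen hL a - Finsupp.single i 1 : Fin (N + 1) →₀ ℕ) (Fin.last N) = lastExp hL a := by
      simp [toMinGen_last, Finsupp.single_eq_of_ne (Ne.symm hil)]
    by_cases he : lastExp hL a = 0
    · have h2 := congrArg Finsupp.degree h1
      rw [map_add, Finsupp.degree_single] at h2
      have h3 := hL.le_degree _ hsub
      have h4 := degree_toMinGen hL a
      omega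
    · have hmove := hL.move _ hsub (Fin.last N) (by omega) i (Fin.lt_last_iff_ne_last.2 hil)
      have := hlast _ hmove fun j hj => by
        rw [← toMinGen_of_ne hL a hj]
        conv_rhs => rw [← h1]
        simp [Finsupp.single_eq_of_ne hj]
      simp only [Finsupp.add_apply, Finsupp.tsub_apply, Finsupp.single_eq_same, toMinGen_last,
        Finsupp.single_eq_of_ne (Ne.symm hil)] at this
      omega

/-- The image retains every exponent but the last, which the degree determines. -/
lemma toMinGen_injOn : Set.InjOn (toMinGen hL) {a | a.degree = d} := by
  intro a ha b hb hab
  have h1 : ∀ j ≠ Fin.last N, a j = b j := fun j hj => by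
    rw [← toMinGen_of_ne hL a hj, ← toMinGen_of_ne hL b hj, hab]
  have h2 := degree_toMinGen hL a
  have h3 := degree_toMinGen hL b
  have h4 := congrArg Finsupp.degree hab
  have h5 := DFunLike.congr_fun hab (Fin.last N)
  rw [toMinGen_last, toMinGen_last] at h5
  change a.degree = d at ha
  change b.degree = d at hb
  ext j
  by_cases hj : j = Fin.last N
  · rw [hj]
    omega
  · exact h1 j hj

lemma exists_toMinGen_eq {g : Fin (N + 1) →₀ ℕ} (hg : g ∈ minGens L) :
    ∃ a, a.degree = d ∧ toMinGen hL a = g := by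
  have hdeg : ∀ q, (g.update (Fin.last N) q).degree + g (Fin.last N) = g.degree + q := fun q => by
    rw [degree_eq_sum_univ, degree_eq_sum_univ, Fin.sum_univ_castSucc, Fin.sum_univ_castSucc,
      Finset.sum_congr rfl fun i _ => show (g.update (Fin.last N) q) i.castSucc = g i.castSucc by
        simp [(Fin.castSucc_lt_last i).ne]]
    simp
    omega
  -- Outside the last variable `g` has degree at most `d`: otherwise a monomial of degree `d`
  -- without that variable, which lies in `L`, would divide it properly. The last exponent can thus
  -- be adjusted to reach total degree `d`.
  have hle : g.degree ≤ d + g (Fin.last N) := by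
    by_contra! hcon
    have h0 := hdeg 0
    obtain ⟨v, hv, hvd⟩ : ∃ v ≤ g.update (Fin.last N) 0, v.degree = d := by
      exact Finsupp.exists_le_degree_eq _ _ (by omega)
    have hvl : v (Fin.last N) = 0 := by simpa using hv (Fin.last N)
    have hvL := hL.mem_of_last v hvd hvl
    have hvg : v ≤ g := fun i => by
      by_cases hi : i = Fin.last N
      · rw [hi, hvl]; exact Nat.zero_le _
      · simpa [hi] using hv i
    have := congrArg Finsupp.degree (hg.eq_of_le hvL hvg)
    have := hL.le_degree g hg.1
    omega
  refine ⟨g.update (Fin.last N) (d + g (Fin.last N) - g.degree), ?_, ?_⟩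
  · have := hdeg (d + g (Fin.last N) - g.degree)
    omega
  · refine hg.eq_of_le (toMinGen_mem hL _) fun j => ?_
    by_cases hj : j = Fin.last N
    · rw [hj, toMinGen_last]
      refine lastExp_le hL ?_
      simpa using hg.1
    · rw [toMinGen_of_ne hL _ hj]
      simp [hj]

lemma image_toMinGen :
    toMinGen hL '' (Finset.finsuppAntidiag (Finset.univ : Finset (Fin (N + 1))) d : Set _) =
      minGens L := by
  ext g
  constructor
  · rintro ⟨a, ha, rfl⟩
    exact toMinGen_mem_minGens hL (mem_finsuppAntidiag_univ.1 ha)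
  · intro hg
    obtain ⟨a, ha, rfl⟩ := exists_toMinGen_eq hL hg
    exact ⟨a, mem_finsuppAntidiag_univ.2 ha, rfl⟩

lemma finite_minGens : (minGens L).Finite := by
  rw [← image_toMinGen hL]
  exact (Finset.finite_toSet _).image _

lemma encard_minGens : (minGens L).encard =
    (Finset.finsuppAntidiag (Finset.univ : Finset (Fin (N + 1))) d).card := by
  rw [← image_toMinGen hL, Set.InjOn.encard_image, Set.encard_coe_eq_coe_finsetCard]
  exact fun a ha b hb => toMinGen_injOn hL (mem_finsuppAntidiag_univ.1 ha)
    (mem_finsuppAntidiag_univ.1 hb)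

lemma sum_minGens [Fintype (minGens L)] (p : ℕ) :
    ∑ a : minGens L, (belowMax a.1).card.choose p =
      ∑ a ∈ Finset.finsuppAntidiag (Finset.univ : Finset (Fin (N + 1))) d,
        (belowMax a).card.choose p := by
  symm
  refine Finset.sum_bij (fun a ha => (⟨toMinGen hL a,
    toMinGen_mem_minGens hL (mem_finsuppAntidiag_univ.1 ha)⟩ : minGens L)) ?_ ?_ ?_ ?_
  · exact fun _ _ => Finset.mem_univ _
  · exact fun a ha b hb hab => toMinGen_injOn hL (mem_finsuppAntidiag_univ.1 ha)
      (mem_finsuppAntidiag_univ.1 hb) (congrArg Subtype.val hab)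
  · rintro ⟨g, hg⟩ -
    obtain ⟨a, ha, rfl⟩ := exists_toMinGen_eq hL hg
    exact ⟨a, mem_finsuppAntidiag_univ.2 ha, rfl⟩
  · intro a ha
    dsimp only
    rw [belowMax_toMinGen hL (mem_finsuppAntidiag_univ.1 ha)]

theorem IsArtinianStable.totalBetti_quotient {k : Type u} [Field k] (hd : 1 ≤ d) (p : ℕ) :
    totalBetti (n := N + 1) (k := k) (p + 1) (MvPolynomial (Fin (N + 1)) k ⧸ monomialSpan k L) =
      ((∑ i ∈ Finset.Icc 1 (N + 1), (d + i - 2).choose (d - 1) * (i - 1).choose p : ℕ) :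
        Cardinal) := by
  have := (finite_minGens hL).fintype
  rw [hL.toIsStableSet.totalBetti_quotient, sum_minGens hL, sum_choose_card_belowMax hd]
  intro h0
  have := hL.le_degree 0 h0
  rw [map_zero] at this
  omega

end Extend

/-! ### Uniqueness of the minimal monomial generating set -/

section MinimalGenerators

variable {L : Set (Fin n →₀ ℕ)}

lemma minGens_subset_of_monomialSpan_eq (hL : IsUpperSet L) {S : Set (Fin n →₀ ℕ)}
    (hS : monomialSpan k S = monomialSpan k L) : minGens L ⊆ S := by
  intro g hg
  have h1 : monomial g (1 : k) ∈ monomialSpan k S :=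
    hS ▸ (monomial_mem_monomialSpan hL).2 hg.1
  obtain ⟨s, hs, hsg⟩ := mem_ideal_span_monomial_image.1 h1 g (by classical simp [support_monomial])
  have h2 : s ∈ L := (monomial_mem_monomialSpan (k := k) hL).1
    (hS ▸ Ideal.subset_span ⟨s, hs, rfl⟩)
  rwa [hg.eq_of_ge h2 hsg]

lemma minimallyGenerates_iff (hL : IsUpperSet L) {S : Set (Fin n →₀ ℕ)} :
    MinimallyGenerates S (monomialSpan k L) ↔ S = minGens L := by
  constructor
  · rintro ⟨h1, h2⟩
    by_contra hne
    exact h2 (minGens L) ((minGens_subset_of_monomialSpan_eq hL h1).ssubset_of_ne (Ne.symm hne))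
      (monomialSpan_minGens L)
  · rintro rfl
    exact ⟨monomialSpan_minGens L, fun T hT h =>
      hT.2 (minGens_subset_of_monomialSpan_eq hL h)⟩

end MinimalGenerators

/-! ### From ideals to sets of exponent vectors -/

lemma maxIdeal_pow_eq_monomialSpan (d : ℕ) :
    maxIdeal n k ^ d = monomialSpan k {a | d ≤ a.degree} := by
  ext c
  rw [mem_maxIdeal_pow_iff, monomialSpan, mem_ideal_span_monomial_image]
  exact forall₂_congr fun x _ => ⟨fun h => ⟨x, h, le_rfl⟩,
    fun ⟨y, hy, hyx⟩ => le_trans hy (Finsupp.degree_mono hyx)⟩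

/-- Puts `𝔪^d` in the same class as `J`, so that one formula gives both sets of Betti numbers. -/
lemma isArtinianStable_degree_ge (N d : ℕ) :
    IsArtinianStable {a : Fin (N + 1) →₀ ℕ | d ≤ a.degree} d where
  isUpperSet := fun _ _ hab ha => le_trans ha (Finsupp.degree_mono hab)
  move := fun a ha i hi j _ => by
    have h1 : a - Finsupp.single i 1 + Finsupp.single i 1 = a :=
      tsub_add_cancel_of_le (by rw [Finsupp.single_le_iff]; omega)
    have h2 := congrArg Finsupp.degree h1
    change d ≤ a.degree at ha
    change d ≤ (a - Finsupp.single i 1 + Finsupp.single j 1).degree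
    rw [map_add, Finsupp.degree_single] at h2 ⊢
    omega
  le_degree := fun _ ha => ha
  mem_of_last := fun _ ha _ => ha.ge
  exists_pow := ⟨d, by simp⟩

lemma monomialSpan_setOf_mem {J : Ideal (MvPolynomial (Fin n) k)} (hJ : IsMonomialIdeal J) :
    monomialSpan k {a | monomial a (1 : k) ∈ J} = J := by
  obtain ⟨S, rfl⟩ := hJ
  refine le_antisymm ?_ (Ideal.span_mono (Set.image_mono fun a ha => ?_))
  · rw [monomialSpan, Ideal.span_le]
    rintro _ ⟨a, ha, rfl⟩
    exact ha
  · exact Ideal.subset_span ⟨a, ha, rfl⟩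

lemma isUpperSet_setOf_monomial_mem (J : Ideal (MvPolynomial (Fin n) k)) :
    IsUpperSet {a | monomial a (1 : k) ∈ J} := by
  intro a b hab ha
  have : monomial b (1 : k) = monomial (b - a) 1 * monomial a 1 := by
    rw [monomial_mul, tsub_add_cancel_of_le hab, one_mul]
  change monomial b (1 : k) ∈ J
  rw [this]
  exact J.mul_mem_left _ ha

lemma GeneratedInDegreesGE.le_maxIdeal_pow {J : Ideal (MvPolynomial (Fin n) k)} {d : ℕ}
    (hJ : GeneratedInDegreesGE J d) : J ≤ maxIdeal n k ^ d := by
  obtain ⟨G, hG, rfl⟩ := hJ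
  rw [Ideal.span_le]
  intro g hg
  obtain ⟨e, hde, hge⟩ := hG g hg
  refine mem_maxIdeal_pow_iff.2 fun x hx => ?_
  by_contra hcon
  exact mem_support_iff.1 hx (hge.coeff_eq_zero (by omega))

/-- The chain of powers of `x_i` stabilizes modulo `J`, so `x_i^(q+1) y - x_i^q ∈ J` for some `q`
and `y`. The term `x_i^q` cannot cancel, and a monomial ideal contains the monomials of its
elements. -/
lemma exists_single_mem_of_isArtinianRing {J : Ideal (MvPolynomial (Fin n) k)}
    (hJ : IsMonomialIdeal J) (hArt : IsArtinianRing (MvPolynomial (Fin n) k ⧸ J)) (i : Fin n) :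
    ∃ q, monomial (Finsupp.single i q) (1 : k) ∈ J := by
  classical
  obtain ⟨q, y, hy⟩ := IsArtinian.exists_pow_succ_smul_dvd (Ideal.Quotient.mk J (X i))
    (1 : MvPolynomial (Fin n) k ⧸ J)
  obtain ⟨y, rfl⟩ := Ideal.Quotient.mk_surjective y
  have h1 : X i ^ (q + 1) * y - X i ^ q ∈ J := by
    rw [← Ideal.Quotient.eq, map_mul, map_pow, map_pow]
    simpa using hy
  refine ⟨q, ?_⟩
  have hJ' := monomialSpan_setOf_mem hJ
  rw [← hJ', monomialSpan, mem_ideal_span_monomial_image] at h1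
  obtain ⟨a, ha, hle⟩ := h1 (Finsupp.single i q) (by
    rw [mem_support_iff, coeff_sub, X_pow_eq_monomial, coeff_monomial_mul', X_pow_eq_monomial,
      coeff_monomial, if_pos rfl, if_neg]
    · simp
    · rw [Finsupp.single_le_iff]
      simp)
  exact isUpperSet_setOf_monomial_mem J hle ha

lemma exists_isArtinianStable {N d : ℕ} (J : Ideal (MvPolynomial (Fin (N + 1)) k))
    (hJ : IsStronglyStable J) (hdeg : GeneratedInDegreesGE J d)
    (hcontains : ∀ a : Fin (N + 1) →₀ ℕ, a.degree = d → a (Fin.last N) = 0 →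
      monomial a (1 : k) ∈ J)
    (hArt : IsArtinianRing (MvPolynomial (Fin (N + 1)) k ⧸ J)) :
    ∃ L, IsArtinianStable L d ∧ monomialSpan k L = J :=
  ⟨{a | monomial a (1 : k) ∈ J},
    { isUpperSet := isUpperSet_setOf_monomial_mem J
      move := hJ.2
      le_degree := fun a ha =>
        (monomial_mem_pow_idealOfVars_iff d a one_ne_zero).1 (hdeg.le_maxIdeal_pow ha)
      mem_of_last := hcontains
      exists_pow := exists_single_mem_of_isArtinianRing hJ.1 hArt (Fin.last N) },
    monomialSpan_setOf_mem hJ.1⟩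

end StronglyStableBetti

end

open StronglyStableBetti in
theorem theorem4p1 {k : Type*} [Field k] (n : ℕ) (hn : 1 ≤ n) (d : ℕ) (hd : 2 ≤ d)
    (J : Ideal (MvPolynomial (Fin n) k))
    (hJ : StronglyStableBetti.IsStronglyStable J)
    (hdeg : StronglyStableBetti.GeneratedInDegreesGE J d)
    (hcontains : ∀ a : Fin n →₀ ℕ, a.degree = d → a ⟨n - 1, Nat.sub_lt hn Nat.one_pos⟩ = 0 →
      MvPolynomial.monomial a (1 : k) ∈ J)
    (hArt : IsArtinianRing (MvPolynomial (Fin n) k ⧸ J)) :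
    (∀ p : ℕ, 1 ≤ p →
      StronglyStableBetti.totalBetti (n := n) (k := k) p (MvPolynomial (Fin n) k ⧸ J) =
        StronglyStableBetti.totalBetti (n := n) (k := k) p
          (MvPolynomial (Fin n) k ⧸ StronglyStableBetti.maxIdeal n k ^ d) ∧
      StronglyStableBetti.totalBetti (n := n) (k := k) p
          (MvPolynomial (Fin n) k ⧸ StronglyStableBetti.maxIdeal n k ^ d) =
        ((∑ i ∈ Finset.Icc 1 n,
          (d + i - 2).choose (d - 1) * (i - 1).choose (p - 1) : ℕ) : Cardinal)) ∧
    (∃ S : Set (Fin n →₀ ℕ), StronglyStableBetti.MinimallyGenerates S J) ∧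
    (∀ S : Set (Fin n →₀ ℕ), StronglyStableBetti.MinimallyGenerates S J →
      S.encard = (Module.finrank k (MvPolynomial.homogeneousSubmodule (Fin n) k d) : ℕ∞)) := by
  obtain ⟨N, rfl⟩ : ∃ N, n = N + 1 := ⟨n - 1, by omega⟩
  obtain ⟨L, hL, rfl⟩ := exists_isArtinianStable J hJ hdeg hcontains hArt
  refine ⟨fun p hp => ?_, ⟨minGens L, (minimallyGenerates_iff hL.isUpperSet).2 rfl⟩,
    fun S hS => ?_⟩
  · obtain ⟨p, rfl⟩ : ∃ q, p = q + 1 := ⟨p - 1, by omega⟩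
    rw [maxIdeal_pow_eq_monomialSpan,
      (isArtinianStable_degree_ge N d).totalBetti_quotient (by omega),
      hL.totalBetti_quotient (by omega), Nat.add_sub_cancel]
    exact ⟨rfl, rfl⟩
  · rw [(minimallyGenerates_iff hL.isUpperSet).1 hS, encard_minGens hL,
      finrank_homogeneousSubmodule]
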